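/- Let $\tau\in\mathbf C$ with $\operatorname{Im}\tau>0$, let $q=e^{-2i\pi\tau}$ (so $|q|>1$), and put $q^y=e^{-2i\pi\tau y}$ for $y\in\mathbf R$; every element of $\mathbf C^*$ can be written uniquely as $uq^y$ with $|u|=1$ and $y\in\mathbf R$. Let $\mathcal P^{(0)}$ be the category of flat $q$-difference systems: its objects are the pairs $(\mathbf C^n,A)$ with $n\in\mathbf N$ and $A\in GL_n(\mathbf C)$, and its morphisms $(\mathbf C^n,A)\to(\mathbf C^p,B)$ are the $p\times n$ matrices $F$ of meromorphic functions on $\mathbf C$ such that $F(qz)A=BF(z)$; the tensor product is $(\mathbf C^m,A)\otimes(\mathbf C^n,B)=(\mathbf C^{mn},A\otimes B)$ and the unit object is $(\mathbf C,1)$. For $z_0\in\mathbf C^*$ let $\omega_{z_0}$ be the fibre functor $(\mathbf C^n,A)\mapsto\mathbf C^n$, $F\mapsto F(z_0)$. The local Galois group is $G^{(0)}=\mathrm{Aut}^\otimes(\omega_{z_0})$, with the Zariski topology in which the closed sets are the sets of common zeros of families of regular functions; the regular functions form the $\mathbf C$-algebra generated by the matrix coefficients of $\Phi\mapsto\Phi_X$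 and of $\Phi\mapsto\Phi_X^{-1}$, for all objects $X$ of $\mathcal P^{(0)}$. An element $(\gamma,\lambda)\in\mathrm{Hom}_{grp}(\mathbf C^*,\mathbf C^*)\times\mathbf C$ acts on an object $(\mathbf C^n,A)$ by the matrix $\gamma(A_s)A_u^\lambda$. Here $A=A_sA_u=A_uA_s$ with $A_s$ semi-simple and $A_u$ unipotent; $\gamma(A_s)=Q\,\mathrm{diag}(\gamma(c_1),\dots,\gamma(c_n))\,Q^{-1}$ if $A_s=Q\,\mathrm{diag}(c_1,\dots,c_n)\,Q^{-1}$; and $A_u^\lambda=\sum_{k\ge0}\binom{\lambda}{k}(A_u-I_n)^k$, a finite sum. By this action, for every $z_0\in\mathbf C^*$, the group $\{(\gamma,\lambda)\;:\;\gamma(q)=1\}$ is identified (isomorphically) with $G^{(0)}$. Let $\gamma_1,\gamma_2:\mathbf C^*\to\mathbf C^*$ be the characters $\gamma_1(uq^y)=u$ and $\gamma_2(uq^y)=e^{2i\pi y}$ ($|u|=1$, $y\in\mathbf R$). **Theorem (local fundamental group).** The subgroup $\langle\gamma_1,\gamma_2\rangle\times\mathbf Z$ of $\mathrm{Hom}_{grp}(\mathbf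 C^*,\mathbf C^*)\times\mathbf C$, whose unipotent component is $\mathbf Z\subset\mathbf C$ and whose semi-simple component is generated by $\gamma_1$ and $\gamma_2$, is contained in $\{(\gamma,\lambda)\;:\;\gamma(q)=1\}$ and, through the above identification, it is Zariski-dense in the local Galois group $G^{(0)}$. -/

import Mathlib

open scoped Kronecker

noncomputable section

namespace QDiff

/-! ### The category `𝒫⁽⁰⁾` of flat objects, its tensor structure and its fibre functors -/

/-- A flat object `(ℂⁿ, A)` with `A ∈ GL_n(ℂ)`: the `q`-difference system `σ_q X = A X` with
constant coefficients. -/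
structure FlatObj where
  /-- the rank `n` -/
  rank : ℕ
  /-- the matrix `A` -/
  mat : GL (Fin rank) ℂ

/-- The morphisms `(ℂⁿ, A) → (ℂᵖ, B)` of `𝒫⁽⁰⁾`: the `p × n` matrices `F` of meromorphic functions
on `ℂ` such that `(σ_q F) A = B F`, where `(σ_q F)(z) = F (q z)`.

A meromorphic function on `ℂ` is represented by its normal form: it takes its actual value at each
point where it is holomorphic, and the value `0` at each pole.  The functional equation is an
equality of matrices of meromorphic functions, so it is required off a discrete closed set. -/
structure FlatHom (q : ℂˣ) (X Y : FlatObj) where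
  /-- the matrix of functions `F` -/
  toFun : ℂ → Matrix (Fin Y.rank) (Fin X.rank) ℂ
  meromorphic : ∀ i j, MeromorphicNFOn (fun z => toFun z i j) Set.univ
  equivariant : ∀ᶠ z in Filter.codiscrete ℂ,
    toFun (q * z) * (X.mat : Matrix (Fin X.rank) (Fin X.rank) ℂ) =
      (Y.mat : Matrix (Fin Y.rank) (Fin Y.rank) ℂ) * toFun z

/-- The tensor product of two invertible matrices, as an invertible matrix on
`ℂᵐ ⊗ ℂⁿ ≃ ℂ^(m n)`; the product basis is ordered lexicographically. -/
def glTensor {m n : ℕ} (A : GL (Fin m) ℂ) (B : GL (Fin n) ℂ) : GL (Fin (m * n)) ℂ :=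
  Units.map (Matrix.reindexAlgEquiv ℂ ℂ (finProdFinEquiv (m := m) (n := n))).toMonoidHom
    { val := (A : Matrix (Fin m) (Fin m) ℂ) ⊗ₖ (B : Matrix (Fin n) (Fin n) ℂ)
      inv := ((A⁻¹ : GL (Fin m) ℂ) : Matrix (Fin m) (Fin m) ℂ) ⊗ₖ
        ((B⁻¹ : GL (Fin n) ℂ) : Matrix (Fin n) (Fin n) ℂ)
      val_inv := by rw [← Matrix.mul_kronecker_mul]; simp
      inv_val := by rw [← Matrix.mul_kronecker_mul]; simp }

theorem glTensor_mul {m n : ℕ} (A A' : GL (Fin m) ℂ) (B B' : GL (Fin n) ℂ) :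
    glTensor (A * A') (B * B') = glTensor A B * glTensor A' B' := by
  unfold glTensor
  rw [← map_mul]
  congr 1
  ext1
  simp [Matrix.mul_kronecker_mul]

theorem glTensor_one {m n : ℕ} : glTensor (1 : GL (Fin m) ℂ) (1 : GL (Fin n) ℂ) = 1 := by
  have h := glTensor_mul (1 : GL (Fin m) ℂ) 1 (1 : GL (Fin n) ℂ) 1
  simpa using h

/-- The tensor product of two flat objects. -/
def FlatObj.tensor (X Y : FlatObj) : FlatObj := ⟨X.rank * Y.rank, glTensor X.mat Y.mat⟩

/-- The unit object `(ℂ, 1)`. -/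
def FlatObj.unit : FlatObj := ⟨1, 1⟩

/-- The local Galois group `Aut^⊗(ω_{z₀})`, where `ω_{z₀}` is the fibre functor
`(ℂⁿ, A) ↦ ℂⁿ`, `F ↦ F(z₀)` on `𝒫⁽⁰⁾`: the families `(Φ_X)` of automorphisms of the spaces
`ω_{z₀}(X)` that are natural for all morphisms of `𝒫⁽⁰⁾` and compatible with the tensor product
and the unit. -/
def localGaloisGroup (q z₀ : ℂˣ) : Subgroup (∀ X : FlatObj, GL (Fin X.rank) ℂ) where
  carrier := {Φ |
    (∀ (X Y : FlatObj) (F : FlatHom q X Y),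
      F.toFun z₀ * (Φ X : Matrix (Fin X.rank) (Fin X.rank) ℂ) =
        (Φ Y : Matrix (Fin Y.rank) (Fin Y.rank) ℂ) * F.toFun z₀) ∧
    (∀ X Y : FlatObj, Φ (X.tensor Y) = glTensor (Φ X) (Φ Y)) ∧
    Φ FlatObj.unit = 1}
  mul_mem' := by
    rintro Φ Ψ ⟨h1, h2, h3⟩ ⟨k1, k2, k3⟩
    refine ⟨fun X Y F => ?_, fun X Y => ?_, ?_⟩
    · rw [Pi.mul_apply, Pi.mul_apply, Units.val_mul, Units.val_mul, ← Matrix.mul_assoc, h1,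
        Matrix.mul_assoc, k1, Matrix.mul_assoc]
    · rw [Pi.mul_apply, h2, k2]; exact (glTensor_mul _ _ _ _).symm
    · rw [Pi.mul_apply, h3, k3, mul_one]
  one_mem' := by
    refine ⟨fun X Y F => ?_, fun X Y => ?_, rfl⟩
    · simp
    · exact glTensor_one.symm
  inv_mem' := by
    rintro Φ ⟨h1, h2, h3⟩
    refine ⟨fun X Y F => ?_, fun X Y => ?_, ?_⟩
    · have h := h1 X Y F
      calc F.toFun z₀ * (((Φ X)⁻¹ : GL (Fin X.rank) ℂ) : Matrix (Fin X.rank) (Fin X.rank) ℂ)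
          = (((Φ Y)⁻¹ : GL (Fin Y.rank) ℂ) : Matrix (Fin Y.rank) (Fin Y.rank) ℂ) *
              ((Φ Y : Matrix (Fin Y.rank) (Fin Y.rank) ℂ) * F.toFun z₀) *
              (((Φ X)⁻¹ : GL (Fin X.rank) ℂ) : Matrix (Fin X.rank) (Fin X.rank) ℂ) := by
            rw [← Matrix.mul_assoc, Units.inv_mul, Matrix.one_mul]
        _ = _ := by
            rw [← h, Matrix.mul_assoc, Matrix.mul_assoc, Units.mul_inv, Matrix.mul_one]
            rfl
    · have h : glTensor (Φ X)⁻¹ (Φ Y)⁻¹ * glTensor (Φ X) (Φ Y) = 1 := by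
        rw [← glTensor_mul, inv_mul_cancel, inv_mul_cancel, glTensor_one]
      rw [Pi.inv_apply, h2]
      exact (eq_inv_of_mul_eq_one_left h).symm
    · rw [Pi.inv_apply, h3, inv_one]

/-! ### The Zariski topology of the local Galois group -/

/-- The algebra of regular functions on the proalgebraic group `Aut^⊗(ω_{z₀})`: it is generated by
the coefficients of the matrices `Φ_X` and `Φ_X⁻¹`, for all objects `X`. -/
def regularFunctions (q z₀ : ℂˣ) : Subalgebra ℂ (localGaloisGroup q z₀ → ℂ) :=
  Algebra.adjoin ℂ
    ({f | ∃ (X : FlatObj) (i j : Fin X.rank),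
        f = fun Φ => (Φ.1 X : Matrix (Fin X.rank) (Fin X.rank) ℂ) i j} ∪
     {f | ∃ (X : FlatObj) (i j : Fin X.rank),
        f = fun Φ => (((Φ.1 X)⁻¹ : GL (Fin X.rank) ℂ) : Matrix (Fin X.rank) (Fin X.rank) ℂ) i j})

/-- The Zariski topology: the sets `{f ≠ 0}`, for `f` a regular function, form a basis. -/
abbrev zariskiTopology (q z₀ : ℂˣ) : TopologicalSpace (localGaloisGroup q z₀) :=
  TopologicalSpace.generateFrom {U | ∃ f ∈ regularFunctions q z₀, U = {Φ | f Φ ≠ 0}}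

/-- Density for the Zariski topology of the local Galois group. -/
def IsZariskiDense {q z₀ : ℂˣ} (S : Set (localGaloisGroup q z₀)) : Prop :=
  @Dense _ (zariskiTopology q z₀) S

/-! ### The group `Hom(ℂˣ, ℂˣ) × ℂ` and its action -/

/-- The group `ℤ^alg = Hom_grp(ℂˣ, ℂˣ) × ℂ` (the additive group `ℂ` being written
multiplicatively). -/
abbrev ZAlg : Type := (ℂˣ →* ℂˣ) × Multiplicative ℂ

/-- The matrix `M` is `A^(γ, λ) = γ(A_s) A_u^λ`, where `A = A_s A_u` is the multiplicative Dunford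
decomposition: `A_s = Q diag(c₁, …, c_n) Q⁻¹` is semi-simple, `A_u` is unipotent and they commute,
`γ(A_s) = Q diag(γ(c₁), …, γ(c_n)) Q⁻¹` and `A_u^λ = ∑ₖ (λ choose k) (A_u - 1)ᵏ`, a sum whose
terms with `k ≥ n` vanish. -/
def IsIncarnation (g : ZAlg) {n : ℕ} (A M : GL (Fin n) ℂ) : Prop :=
  ∃ (Q : GL (Fin n) ℂ) (c : Fin n → ℂˣ) (As Au : Matrix (Fin n) (Fin n) ℂ),
    As = (Q : Matrix (Fin n) (Fin n) ℂ) * Matrix.diagonal (fun i => (c i : ℂ)) *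
      ((Q⁻¹ : GL (Fin n) ℂ) : Matrix (Fin n) (Fin n) ℂ) ∧
    IsNilpotent (Au - 1) ∧
    Commute As Au ∧
    (A : Matrix (Fin n) (Fin n) ℂ) = As * Au ∧
    (M : Matrix (Fin n) (Fin n) ℂ) =
      ((Q : Matrix (Fin n) (Fin n) ℂ) * Matrix.diagonal (fun i => (g.1 (c i) : ℂ)) *
        ((Q⁻¹ : GL (Fin n) ℂ) : Matrix (Fin n) (Fin n) ℂ)) *
      ∑ k ∈ Finset.range n, Ring.choose (Multiplicative.toAdd g.2) k • (Au - 1) ^ k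

/-- The subgroup `{(γ, λ) | γ(q) = 1}` of `Hom_grp(ℂˣ, ℂˣ) × ℂ`. -/
def evalKer (q : ℂˣ) : Subgroup ZAlg where
  carrier := {g | g.1 q = 1}
  mul_mem' := by
    intro g h hg hh
    simp only [Set.mem_ofPred_eq] at *
    simp [hg, hh]
  one_mem' := by simp
  inv_mem' := by
    intro g hg
    simp only [Set.mem_ofPred_eq] at *
    simp [hg]

/-! ### The two loops and the local fundamental group -/

/-- `q^y = e^{-2iπτy}`, for real `y`. -/
def qPow (τ : ℂ) (y : ℝ) : ℂˣ :=
  Units.mk0 (Complex.exp (-2 * Real.pi * Complex.I * τ * y)) (Complex.exp_ne_zero _)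

/-- The exponent `y` in the decomposition `c = u q^y` with `|u| = 1`. -/
def qExponent (τ : ℂ) (c : ℂˣ) : ℝ := Real.log ‖(c : ℂ)‖ / (2 * Real.pi * τ.im)

theorem qExponent_mul (τ : ℂ) (c d : ℂˣ) :
    qExponent τ (c * d) = qExponent τ c + qExponent τ d := by
  unfold qExponent
  rw [Units.val_mul, norm_mul, Real.log_mul (by simp) (by simp), add_div]

theorem qPow_add (τ : ℂ) (x y : ℝ) : qPow τ (x + y) = qPow τ x * qPow τ y := by
  ext
  simp [qPow, mul_add, Complex.exp_add]

/-- The character `γ₁ : u q^y ↦ u`. -/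
def gamma₁ (τ : ℂ) : ℂˣ →* ℂˣ where
  toFun c := c * (qPow τ (qExponent τ c))⁻¹
  map_one' := by ext; simp [qPow, qExponent]
  map_mul' c d := by rw [qExponent_mul, qPow_add, mul_inv, mul_mul_mul_comm]

/-- The character `γ₂ : u q^y ↦ e^{2iπy}`. -/
def gamma₂ (τ : ℂ) : ℂˣ →* ℂˣ where
  toFun c := Units.mk0 (Complex.exp (2 * Real.pi * Complex.I * qExponent τ c))
    (Complex.exp_ne_zero _)
  map_one' := by ext; simp [qExponent]
  map_mul' c d := by
    ext
    simp [qExponent_mul, mul_add, Complex.exp_add]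

theorem qExponent_mul_qPow {τ : ℂ} (hτ : 0 < τ.im) (u : ℂˣ) (hu : ‖(u : ℂ)‖ = 1) (y : ℝ) :
    qExponent τ (u * qPow τ y) = y := by
  have h : ‖(qPow τ y : ℂ)‖ = Real.exp (2 * Real.pi * τ.im * y) := by
    simp [qPow, Complex.norm_exp]
  have hpi := Real.pi_pos
  unfold qExponent
  rw [Units.val_mul, norm_mul, hu, one_mul, h, Real.log_exp]
  field_simp

theorem gamma₁_apply {τ : ℂ} (hτ : 0 < τ.im) (u : ℂˣ) (hu : ‖(u : ℂ)‖ = 1) (y : ℝ) :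
    gamma₁ τ (u * qPow τ y) = u := by
  change u * qPow τ y * (qPow τ (qExponent τ (u * qPow τ y)))⁻¹ = u
  rw [qExponent_mul_qPow hτ u hu, mul_inv_cancel_right]

theorem gamma₂_apply {τ : ℂ} (hτ : 0 < τ.im) (u : ℂˣ) (hu : ‖(u : ℂ)‖ = 1) (y : ℝ) :
    (gamma₂ τ (u * qPow τ y) : ℂ) = Complex.exp (2 * Real.pi * Complex.I * y) := by
  change Complex.exp (2 * Real.pi * Complex.I * qExponent τ (u * qPow τ y)) = _
  rw [qExponent_mul_qPow hτ u hu]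

/-- The subgroup of `Hom_grp(ℂˣ, ℂˣ) × ℂ` whose semi-simple component is generated by `γ₁` and `γ₂`
and whose unipotent component is `ℤ ⊂ ℂ`. -/
def localFundamentalGroup (τ : ℂ) : Subgroup ZAlg :=
  (Subgroup.closure {gamma₁ τ, gamma₂ τ}).prod
    (AddSubgroup.toSubgroup (Int.castAddHom ℂ).range)

end QDiff

end

/-! The matrix γ(A_s) A_u^λ is controlled by generalized eigenvectors. If (c⁻¹A - 1)^m v = 0, it
sends v to γ(c) times the binomial series of (c⁻¹A)^λ, truncated at m, applied to v. Such vectors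
span because A is invertible, so this property (`ActsAs`) determines the matrix. Multiplicativity,
naturality and compatibility with ⊗ are then checked on these vectors.

Naturality: a Laurent coefficient at 0 of a morphism F intertwines A and B up to a power of q, hence
multiplies eigenvalues by that power, which γ does not see. So F intertwines the two actions near 0
(`FlatHom.eventually_mul_action`), and, as |q| > 1, the functional equation carries this to all of
ℂˣ (`FlatHom.mul_action`).

Conversely, a tensor automorphism Φ acts on rank-one objects by a character γ, and the morphism z
from (ℂ, 1) to (ℂ, q) forces γ(q) = 1. On unipotent objects naturality makes Φ a universal series ∑
aₖ (A - 1)ᵏ; tensoring Jordan blocks gives a recurrence whose solution is aₖ = (a₁ choose k), so λ =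
a₁ (`actsAs_apply`).

Density: let a regular function vanish on the subgroup. For fixed γ it is polynomial in λ, so
vanishing at the integers gives vanishing for every λ. For fixed λ it is a linear combination of
evaluations of γ at points of ℂˣ/q^ℤ. These points are separated by γ₁ and γ₂, so they define
distinct characters of ⟨γ₁, γ₂⟩, and independence of characters makes every coefficient zero
(`eq_zero_of_evalCharacter_eq_zero`). -/

noncomputable section

namespace QDiff

open Matrix Filter Topology

/-! ### Generalized eigenvectors and truncated binomial series -/

/-- The matrix `c⁻¹ A - 1`, nilpotent on the generalized eigenspace of `A` for the eigenvalue `c`. -/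
def nilpotentPart {n : ℕ} (A : Matrix (Fin n) (Fin n) ℂ) (c : ℂˣ) : Matrix (Fin n) (Fin n) ℂ :=
  ((c⁻¹ : ℂˣ) : ℂ) • A - 1

/-- The truncated binomial series `∑_{k < m} (λ choose k) Nᵏ`. -/
def binomialSum {n : ℕ} (a : ℂ) (m : ℕ) (N : Matrix (Fin n) (Fin n) ℂ) :
    Matrix (Fin n) (Fin n) ℂ :=
  ∑ k ∈ Finset.range m, Ring.choose a k • N ^ k

/-- The matrix `M` acts on the generalized eigenvectors of `A` as `(γ, λ)` should:
by `γ(c) (c⁻¹ A)^λ` on those with eigenvalue `c`. -/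
def ActsAs (g : ZAlg) {n : ℕ} (A M : Matrix (Fin n) (Fin n) ℂ) : Prop :=
  ∀ (c : ℂˣ) (m : ℕ) (v : Fin n → ℂ), nilpotentPart A c ^ m *ᵥ v = 0 →
    M *ᵥ v = (g.1 c : ℂ) • (binomialSum (Multiplicative.toAdd g.2) m (nilpotentPart A c) *ᵥ v)

theorem pow_mulVec_eq_zero_of_le {n : ℕ} {N : Matrix (Fin n) (Fin n) ℂ} {v : Fin n → ℂ}
    {k m : ℕ} (h : N ^ k *ᵥ v = 0) (hkm : k ≤ m) : N ^ m *ᵥ v = 0 := by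
  obtain ⟨l, rfl⟩ := Nat.exists_eq_add_of_le hkm
  rw [add_comm, pow_add, ← mulVec_mulVec, h, mulVec_zero]

theorem binomialSum_mulVec {n : ℕ} (a : ℂ) (m : ℕ) (N : Matrix (Fin n) (Fin n) ℂ)
    (v : Fin n → ℂ) :
    binomialSum a m N *ᵥ v = ∑ k ∈ Finset.range m, Ring.choose a k • (N ^ k *ᵥ v) := by
  simp only [binomialSum, sum_mulVec, smul_mulVec]

theorem sum_range_smul_pow_mulVec_of_le {n : ℕ} {N : Matrix (Fin n) (Fin n) ℂ} {v : Fin n → ℂ}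
    {k m : ℕ} (h : N ^ k *ᵥ v = 0) (hkm : k ≤ m) (a : ℕ → ℂ) :
    ∑ i ∈ Finset.range m, a i • (N ^ i *ᵥ v) = ∑ i ∈ Finset.range k, a i • (N ^ i *ᵥ v) := by
  symm
  refine Finset.sum_subset (Finset.range_mono hkm) fun i _ hi => ?_
  rw [pow_mulVec_eq_zero_of_le h (by simpa using hi), smul_zero]

theorem binomialSum_mulVec_of_le {n : ℕ} {N : Matrix (Fin n) (Fin n) ℂ} {v : Fin n → ℂ}
    {k m : ℕ} (h : N ^ k *ᵥ v = 0) (hkm : k ≤ m) (a : ℂ) :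
    binomialSum a m N *ᵥ v = binomialSum a k N *ᵥ v := by
  rw [binomialSum_mulVec, binomialSum_mulVec, sum_range_smul_pow_mulVec_of_le h hkm]

theorem binomialSum_mulVec_congr {n : ℕ} {N : Matrix (Fin n) (Fin n) ℂ} {v : Fin n → ℂ}
    {k m : ℕ} (hk : N ^ k *ᵥ v = 0) (hm : N ^ m *ᵥ v = 0) (a : ℂ) :
    binomialSum a m N *ᵥ v = binomialSum a k N *ᵥ v := by
  rcases le_total k m with h | h
  · exact binomialSum_mulVec_of_le hk h a
  · exact (binomialSum_mulVec_of_le hm h a).symm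

theorem binomialSum_natCast_mulVec {n : ℕ} {N : Matrix (Fin n) (Fin n) ℂ} {v : Fin n → ℂ}
    {m : ℕ} (h : N ^ m *ᵥ v = 0) (j : ℕ) :
    binomialSum (j : ℂ) m N *ᵥ v = (1 + N) ^ j *ᵥ v := by
  -- The length `j + 1 + m` is at least both `j + 1`, enough for the full binomial formula, and `m`,
  -- beyond which the terms kill `v`.
  have h1 : binomialSum (j : ℂ) (j + 1 + m) N = (1 + N) ^ j := by
    rw [add_comm 1 N, (Commute.one_right N).add_pow, binomialSum]
    symm
    refine Finset.sum_subset_zero_on_sdiff (Finset.range_mono (by omega)) (fun k hk => ?_)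
      (fun k _ => ?_)
    · simp only [Finset.mem_sdiff, Finset.mem_range, not_lt] at hk
      rw [Ring.choose_natCast, Nat.choose_eq_zero_of_lt (by omega)]
      simp
    · rw [Ring.choose_natCast, one_pow, mul_one, ← nsmul_eq_mul', Nat.cast_smul_eq_nsmul]
  rw [← h1, binomialSum_mulVec_of_le h (Nat.le_add_left m (j + 1))]

/-- In each term of the binomial expansion, either the exponent of `X` is at least `a` or that of
`Y` is at least `b`. -/
theorem pow_add_mulVec_eq_zero {n : ℕ} {X Y : Matrix (Fin n) (Fin n) ℂ} (hXY : Commute X Y)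
    {v : Fin n → ℂ} {a b : ℕ} (hX : X ^ a *ᵥ v = 0) (hY : Y ^ b *ᵥ v = 0) :
    (X + Y) ^ (a + b) *ᵥ v = 0 := by
  rw [hXY.add_pow, sum_mulVec]
  refine Finset.sum_eq_zero fun k _ => ?_
  rw [← nsmul_eq_mul', smul_mulVec]
  rcases le_or_gt a k with h | h
  · rw [(hXY.pow_pow _ _).eq, ← mulVec_mulVec, pow_mulVec_eq_zero_of_le hX h, mulVec_zero,
      smul_zero]
  · rw [← mulVec_mulVec, pow_mulVec_eq_zero_of_le hY (by omega), mulVec_zero, smul_zero]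

/-- Over ℂ the generalized eigenspaces span, and the eigenvalue 0 contributes nothing because `A` is
invertible; hence units `c` suffice. -/
theorem eq_top_of_generalizedEigenvectors {n : ℕ} {A : Matrix (Fin n) (Fin n) ℂ} (hA : IsUnit A)
    (W : Submodule ℂ (Fin n → ℂ))
    (hW : ∀ (c : ℂˣ) (m : ℕ) (v : Fin n → ℂ), nilpotentPart A c ^ m *ᵥ v = 0 → v ∈ W) :
    W = ⊤ := by
  rw [eq_top_iff, ← Module.End.iSup_maxGenEigenspace_eq_top (Matrix.toLin' A)]
  refine iSup_le fun μ v hv => ?_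
  rw [Module.End.mem_maxGenEigenspace] at hv
  obtain ⟨k, hk⟩ := hv
  have e : Matrix.toLin' A - μ • 1 = Matrix.toLin' (A - μ • 1) := by simp [Module.End.one_eq_id]
  rw [e, ← Matrix.toLin'_pow, Matrix.toLin'_apply] at hk
  by_cases hμ : μ = 0
  · subst hμ
    rw [zero_smul, sub_zero] at hk
    have : v = 0 := by
      have hu := hA.pow k
      have := Matrix.mulVec_injective_of_isUnit hu
      exact this (by simpa using hk)
    rw [this]; exact W.zero_mem
  · refine hW (Units.mk0 μ hμ) k v ?_
    have : nilpotentPart A (Units.mk0 μ hμ) = μ⁻¹ • (A - μ • 1) := by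
      simp [nilpotentPart, smul_sub, smul_smul, hμ]
    rw [this, smul_pow, smul_mulVec, hk, smul_zero]

theorem eq_of_forall_generalizedEigenvector {n p : ℕ} {A : Matrix (Fin n) (Fin n) ℂ}
    (hA : IsUnit A) {M M' : Matrix (Fin p) (Fin n) ℂ}
    (h : ∀ (c : ℂˣ) (m : ℕ) (v : Fin n → ℂ), nilpotentPart A c ^ m *ᵥ v = 0 →
      M *ᵥ v = M' *ᵥ v) : M = M' := by
  have := eq_top_of_generalizedEigenvectors hA
    (LinearMap.eqLocus (Matrix.toLin' M) (Matrix.toLin' M')) (fun c m v hv => by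
      simpa using h c m v hv)
  rw [LinearMap.eqLocus_eq_top] at this
  exact Matrix.toLin'.injective this

theorem ActsAs.unique {g : ZAlg} {n : ℕ} {A M M' : Matrix (Fin n) (Fin n) ℂ} (hA : IsUnit A)
    (h : ActsAs g A M) (h' : ActsAs g A M') : M = M' :=
  eq_of_forall_generalizedEigenvector hA fun c m v hv => by rw [h c m v hv, h' c m v hv]

theorem aeval_mulVec_congr {n : ℕ} {N : Matrix (Fin n) (Fin n) ℂ} {v : Fin n → ℂ}
    {m : ℕ} (h : N ^ m *ᵥ v = 0) {p r : Polynomial ℂ} (hpr : Polynomial.X ^ m ∣ p - r) :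
    Polynomial.aeval N p *ᵥ v = Polynomial.aeval N r *ᵥ v := by
  obtain ⟨s, hs⟩ := hpr
  rw [← sub_eq_zero, ← sub_mulVec, ← map_sub, hs, mul_comm, map_mul, map_pow, Polynomial.aeval_X,
    ← mulVec_mulVec, h, mulVec_zero]

theorem binomialSum_eq_aeval {n : ℕ} (a : ℂ) (m : ℕ) (N : Matrix (Fin n) (Fin n) ℂ) :
    binomialSum a m N = Polynomial.aeval N
      (∑ k ∈ Finset.range m, Polynomial.C (Ring.choose a k) * Polynomial.X ^ k) := by
  simp [binomialSum, Algebra.smul_def]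

/-- This is the Chu–Vandermonde identity, read as a congruence of polynomials modulo `X ^ m`. -/
theorem binomialSum_add_mulVec {n : ℕ} {N : Matrix (Fin n) (Fin n) ℂ} {v : Fin n → ℂ}
    {m : ℕ} (h : N ^ m *ᵥ v = 0) (a b : ℂ) :
    binomialSum (a + b) m N *ᵥ v = binomialSum a m N *ᵥ (binomialSum b m N *ᵥ v) := by
  rw [mulVec_mulVec]
  simp only [binomialSum_eq_aeval, ← map_mul]
  refine aeval_mulVec_congr h (Polynomial.X_pow_dvd_iff.2 fun d hd => ?_)
  rw [Polynomial.coeff_sub, Polynomial.coeff_mul, sub_eq_zero]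
  have hc : ∀ (x : ℂ) (i : ℕ), i ≤ d → (∑ k ∈ Finset.range m,
      Polynomial.C (Ring.choose x k) * Polynomial.X ^ k).coeff i = Ring.choose x i := by
    intro x i hi
    rw [Polynomial.finsetSum_coeff]
    simp only [Polynomial.coeff_C_mul_X_pow]
    rw [Finset.sum_ite_eq, if_pos (Finset.mem_range.2 (by omega))]
  rw [hc _ _ le_rfl, Ring.add_choose_eq d (Commute.all a b)]
  refine Finset.sum_congr rfl fun ij hij => ?_
  have := Finset.HasAntidiagonal.mem_antidiagonal.1 hij
  rw [hc _ _ (by omega), hc _ _ (by omega)]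

theorem commute_binomialSum {n : ℕ} {N X : Matrix (Fin n) (Fin n) ℂ} (h : Commute X N)
    (a : ℂ) (m : ℕ) : Commute X (binomialSum a m N) :=
  Commute.sum_right _ _ _ fun k _ => (h.pow_right k).smul_right _

/-- `M'` maps a generalized eigenvector to one with the same `c` and `m`, so the two descriptions
can be composed. -/
theorem ActsAs.mul {g h : ZAlg} {n : ℕ} {A M M' : Matrix (Fin n) (Fin n) ℂ}
    (hM : ActsAs g A M) (hM' : ActsAs h A M') : ActsAs (g * h) A (M * M') := by
  intro c m v hv
  have hv' : nilpotentPart A c ^ m *ᵥ (M' *ᵥ v) = 0 := by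
    rw [hM' c m v hv, mulVec_smul, mulVec_mulVec,
      (commute_binomialSum (Commute.pow_left rfl m) _ _).eq, ← mulVec_mulVec, hv, mulVec_zero,
      smul_zero]
  rw [← mulVec_mulVec, hM c m _ hv', hM' c m v hv, mulVec_smul, smul_smul, Prod.snd_mul,
    toAdd_mul, binomialSum_add_mulVec hv]
  simp

/-- `F` carries generalized eigenvectors for `c` to generalized eigenvectors for `d * c` and
respects the nilpotent parts; the scalars agree since γ(d) = 1. The factor `d` is what accommodates
the powers of `q` in Laurent expansions. -/
theorem ActsAs.intertwines {g : ZAlg} {n p : ℕ} {A MA : Matrix (Fin n) (Fin n) ℂ}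
    {B MB : Matrix (Fin p) (Fin p) ℂ} (hA : IsUnit A) (hMA : ActsAs g A MA) (hMB : ActsAs g B MB)
    {F : Matrix (Fin p) (Fin n) ℂ} {d : ℂˣ} (hd : g.1 d = 1) (hF : (d : ℂ) • (F * A) = B * F) :
    F * MA = MB * F := by
  refine eq_of_forall_generalizedEigenvector hA fun c m v hv => ?_
  have hN : nilpotentPart B (d * c) * F = F * nilpotentPart A c := by
    simp only [nilpotentPart, Matrix.sub_mul, Matrix.mul_sub, Matrix.smul_mul, ← hF, smul_smul]
    simp
  have hk : ∀ k, nilpotentPart B (d * c) ^ k * F = F * nilpotentPart A c ^ k := by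
    intro k
    induction k with
    | zero => simp
    | succ k ih => rw [pow_succ, Matrix.mul_assoc, hN, ← Matrix.mul_assoc, ih, Matrix.mul_assoc,
        ← pow_succ]
  rw [← mulVec_mulVec, ← mulVec_mulVec, hMA c m v hv,
    hMB (d * c) m (F *ᵥ v) (by rw [mulVec_mulVec, hk, ← mulVec_mulVec, hv, mulVec_zero]),
    map_mul, hd, one_mul, mulVec_smul]
  congr 1
  rw [binomialSum_mulVec, binomialSum_mulVec, mulVec_sum]
  refine Finset.sum_congr rfl fun k _ => ?_
  rw [mulVec_smul, mulVec_mulVec, mulVec_mulVec, hk]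

/-! ### The multiplicative Dunford decomposition -/

/-- Conjugation of the diagonal matrix with entries `c i` by `Q`. -/
def conjDiagonal {n : ℕ} (Q : GL (Fin n) ℂ) (c : Fin n → ℂ) : Matrix (Fin n) (Fin n) ℂ :=
  (Q : Matrix (Fin n) (Fin n) ℂ) * diagonal c * ((Q⁻¹ : GL (Fin n) ℂ) : Matrix (Fin n) (Fin n) ℂ)

theorem conjDiagonal_mul {n : ℕ} (Q : GL (Fin n) ℂ) (c d : Fin n → ℂ) :
    conjDiagonal Q c * conjDiagonal Q d = conjDiagonal Q (fun i => c i * d i) := by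
  rw [conjDiagonal, conjDiagonal, conjDiagonal, ← diagonal_mul_diagonal]
  simp only [Matrix.mul_assoc]
  rw [← Matrix.mul_assoc _ (Q : Matrix (Fin n) (Fin n) ℂ), Units.inv_mul, Matrix.one_mul]

theorem conjDiagonal_one {n : ℕ} (Q : GL (Fin n) ℂ) : conjDiagonal Q (fun _ => 1) = 1 := by
  rw [conjDiagonal, diagonal_one, Matrix.mul_one, Units.mul_inv]

theorem conjDiagonal_const {n : ℕ} (Q : GL (Fin n) ℂ) (a : ℂ) :
    conjDiagonal Q (fun _ => a) = a • 1 := by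
  have : (diagonal fun _ : Fin n => a) = a • (1 : Matrix (Fin n) (Fin n) ℂ) := by
    rw [smul_one_eq_diagonal]
  rw [conjDiagonal, this, Matrix.mul_smul, Matrix.mul_one, Matrix.smul_mul, Units.mul_inv]

theorem conjDiagonal_sub {n : ℕ} (Q : GL (Fin n) ℂ) (c d : Fin n → ℂ) :
    conjDiagonal Q c - conjDiagonal Q d = conjDiagonal Q (fun i => c i - d i) := by
  rw [conjDiagonal, conjDiagonal, conjDiagonal, ← diagonal_sub, Matrix.mul_sub, Matrix.sub_mul]

theorem conjDiagonal_pow {n : ℕ} (Q : GL (Fin n) ℂ) (c : Fin n → ℂ) (k : ℕ) :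
    conjDiagonal Q c ^ k = conjDiagonal Q (fun i => c i ^ k) := by
  induction k with
  | zero => simp [conjDiagonal_one]
  | succ k ih => rw [pow_succ, ih, conjDiagonal_mul]; simp only [pow_succ]

theorem conjDiagonal_mulVec_eq_zero_iff {n : ℕ} (Q : GL (Fin n) ℂ) (c : Fin n → ℂ)
    (v : Fin n → ℂ) : conjDiagonal Q c *ᵥ v = 0 ↔
      ∀ i, c i = 0 ∨ (((Q⁻¹ : GL (Fin n) ℂ) : Matrix (Fin n) (Fin n) ℂ) *ᵥ v) i = 0 := by
  have hQ : Function.Injective (Q : Matrix (Fin n) (Fin n) ℂ).mulVec :=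
    Matrix.mulVec_injective_of_isUnit Q.isUnit
  rw [conjDiagonal, ← mulVec_mulVec, ← mulVec_mulVec, ← mulVec_zero (Q : Matrix (Fin n) (Fin n) ℂ),
    hQ.eq_iff, funext_iff]
  simp [mulVec_diagonal]

theorem conjDiagonal_mulVec_eq_smul_iff {n : ℕ} (Q : GL (Fin n) ℂ) (c : Fin n → ℂ) (d : ℂ)
    (v : Fin n → ℂ) : conjDiagonal Q c *ᵥ v = d • v ↔
      ∀ i, c i = d ∨ (((Q⁻¹ : GL (Fin n) ℂ) : Matrix (Fin n) (Fin n) ℂ) *ᵥ v) i = 0 := by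
  have : conjDiagonal Q c *ᵥ v - d • v = conjDiagonal Q (fun i => c i - d) *ᵥ v := by
    rw [← conjDiagonal_sub, conjDiagonal_const, sub_mulVec, smul_mulVec, one_mulVec]
  rw [← sub_eq_zero, this, conjDiagonal_mulVec_eq_zero_iff]
  simp only [sub_eq_zero]

/-- The data of a multiplicative Dunford decomposition `A = Q diag(c) Q⁻¹ U`. -/
structure IsDunford {n : ℕ} (A : Matrix (Fin n) (Fin n) ℂ) (Q : GL (Fin n) ℂ) (c : Fin n → ℂˣ)
    (U : Matrix (Fin n) (Fin n) ℂ) : Prop where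
  nilpotent : IsNilpotent (U - 1)
  commute : Commute (conjDiagonal Q fun i => (c i : ℂ)) U
  eq_mul : A = conjDiagonal Q (fun i => (c i : ℂ)) * U

/-- The characteristic polynomial differs from `X ^ n` by a nilpotent element of the reduced ring
ℂ[X], so it equals `X ^ n`, and Cayley–Hamilton applies. -/
theorem IsNilpotent.matrix_pow_eq_zero {n : ℕ} {N : Matrix (Fin n) (Fin n) ℂ}
    (h : IsNilpotent N) : N ^ n = 0 := by
  have h1 := Matrix.isNilpotent_charpoly_sub_pow_of_isNilpotent h
  have h2 := sub_eq_zero.1 h1.eq_zero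
  have h3 := Matrix.aeval_self_charpoly N
  rw [h2] at h3
  simpa using h3

/-- A generalized eigenvector of `A` for `d` is a true eigenvector of the semi-simple part `S`. On
it `d⁻¹ A - 1` therefore acts as `U - 1`. -/
theorem IsDunford.actsAs {g : ZAlg} {n : ℕ} {A : Matrix (Fin n) (Fin n) ℂ} {Q : GL (Fin n) ℂ}
    {c : Fin n → ℂˣ} {U : Matrix (Fin n) (Fin n) ℂ} (h : IsDunford A Q c U) :
    ActsAs g A (conjDiagonal Q (fun i => (g.1 (c i) : ℂ)) *
      binomialSum (Multiplicative.toAdd g.2) n (U - 1)) := by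
  intro d m v hv
  set S := conjDiagonal Q (fun i => (c i : ℂ)) with hS
  have hNn := IsNilpotent.matrix_pow_eq_zero h.nilpotent
  set N := U - 1 with hN
  have hU : U = 1 + N := by rw [hN]; abel
  have hSN : Commute S N := h.commute.sub_right (Commute.one_right S)
  have hS' : conjDiagonal Q (fun i => ((d⁻¹ : ℂˣ) : ℂ) * (c i : ℂ) - 1) =
      ((d⁻¹ : ℂˣ) : ℂ) • S - 1 := by
    rw [← conjDiagonal_sub, conjDiagonal_one, ← conjDiagonal_mul, conjDiagonal_const, smul_mul,
      Matrix.one_mul]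
  -- Some power of `d⁻¹ S - 1` kills `v`, as it is a sum of commuting matrices each having a power
  -- that kills `v`. Being diagonalizable, it then kills `v` itself.
  have hsplit : nilpotentPart A d + (-(((d⁻¹ : ℂˣ) : ℂ) • (S * N))) = ((d⁻¹ : ℂˣ) : ℂ) • S - 1 := by
    rw [nilpotentPart, h.eq_mul, hU, Matrix.mul_add, Matrix.mul_one, smul_add]
    abel
  have hcomm : Commute (nilpotentPart A d) (-(((d⁻¹ : ℂˣ) : ℂ) • (S * N))) := by
    have hAS : Commute A (S * N) := by
      rw [h.eq_mul, hU]
      have h1 : Commute (1 + N) S := (Commute.one_left S).add_left hSN.symm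
      have h2 : Commute (1 + N) N := (Commute.one_left N).add_left rfl
      exact ((Commute.refl S).mul_right hSN).mul_left (h1.mul_right h2)
    exact (((hAS.smul_left _).sub_left (Commute.one_left _)).smul_right _).neg_right
  have hnil : (-(((d⁻¹ : ℂˣ) : ℂ) • (S * N))) ^ n *ᵥ v = 0 := by
    rw [neg_pow, smul_pow, hSN.mul_pow, hNn]
    simp
  have hz := pow_add_mulVec_eq_zero hcomm hv hnil
  rw [hsplit, ← hS', conjDiagonal_pow, conjDiagonal_mulVec_eq_zero_iff] at hz
  have hSv : S *ᵥ v = (d : ℂ) • v := by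
    rw [conjDiagonal_mulVec_eq_smul_iff]
    refine fun i => (hz i).imp (fun hi => ?_) id
    have := eq_zero_of_pow_eq_zero hi
    rw [sub_eq_zero, Units.val_inv_eq_inv_val, inv_mul_eq_one₀ d.ne_zero] at this
    exact this.symm
  have hSX : ∀ X, Commute S X → S *ᵥ (X *ᵥ v) = (d : ℂ) • (X *ᵥ v) := by
    intro X hX
    rw [mulVec_mulVec, hX.eq, ← mulVec_mulVec, hSv, mulVec_smul]
  have hpow : ∀ k, nilpotentPart A d ^ k *ᵥ v = N ^ k *ᵥ v := by
    intro k
    induction k with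
    | zero => simp
    | succ k ih =>
      rw [pow_succ', ← mulVec_mulVec, ih, nilpotentPart, h.eq_mul, h.commute.eq, sub_mulVec,
        smul_mulVec, ← mulVec_mulVec, hSX _ (hSN.pow_right k), mulVec_smul, smul_smul,
        Units.inv_mul, one_smul, ← sub_mulVec, mulVec_mulVec, ← hN, ← pow_succ']
  -- The image vector is still a `d`-eigenvector of `S`: in the basis `Q` only coordinates with `c i
  -- = d` survive, where γ(c i) = γ(d).
  have hSb := hSX _ (commute_binomialSum hSN (Multiplicative.toAdd g.2) n)
  rw [conjDiagonal_mulVec_eq_smul_iff] at hSb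
  have hb : binomialSum (Multiplicative.toAdd g.2) m (nilpotentPart A d) *ᵥ v =
      binomialSum (Multiplicative.toAdd g.2) n N *ᵥ v := by
    rw [binomialSum_mulVec_congr (k := m) (m := n) (by rw [← hpow, hv]) (by rw [hNn, zero_mulVec]),
      binomialSum_mulVec, binomialSum_mulVec]
    simp only [hpow]
  rw [← mulVec_mulVec, hb, conjDiagonal_mulVec_eq_smul_iff]
  exact fun i => (hSb i).imp (fun hi => by rw [Units.ext hi]) id

/-- The additive decomposition `f = x + s` is made multiplicative: `s` is invertible, since it
differs from the invertible `f` by a commuting nilpotent, and the unipotent part is s⁻¹f, with s⁻¹f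
- 1 = s⁻¹x. -/
theorem exists_isDunford {n : ℕ} (A : GL (Fin n) ℂ) :
    ∃ (Q : GL (Fin n) ℂ) (c : Fin n → ℂˣ) (U : Matrix (Fin n) (Fin n) ℂ),
      IsDunford (A : Matrix (Fin n) (Fin n) ℂ) Q c U := by
  classical
  set f : Module.End ℂ (Fin n → ℂ) := Matrix.toLin' (A : Matrix (Fin n) (Fin n) ℂ) with hf
  obtain ⟨x, hx, s, hs, hxn, hss, hxs⟩ := f.exists_isNilpotent_isSemisimple
  have hsf : Commute s f := (Algebra.commute_of_mem_adjoin_self hs).symm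
  have hcomm : Commute x s := by
    have : x = f - s := by rw [hxs]; abel
    rw [this]
    exact hsf.symm.sub_left (Commute.refl s)
  have hfu : IsUnit f := by
    have := A.isUnit.map (Matrix.toLinAlgEquiv' (R := ℂ) (n := Fin n))
    exact this
  have hsu : IsUnit s := by
    have : s = f + (-x) := by rw [hxs]; abel
    rw [this]
    refine IsNilpotent.isUnit_add_left_of_commute hxn.neg hfu ?_
    rw [hxs]
    exact ((Commute.refl x).add_left hcomm.symm).neg_right.symm
  -- An eigenbasis of `s`, reindexed by `Fin n`, supplies the columns of `Q`.
  let D := DirectSum.isInternal_submodule_of_iSupIndep_of_iSup_eq_top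
    s.eigenspaces_iSupIndep hss.iSup_eigenspace_eq_top
  let v₀ := D.collectedBasis fun μ => Module.finBasis ℂ (s.eigenspace μ)
  have hv₀ : ∀ i, s (v₀ i) = i.1 • v₀ i := fun i =>
    Module.End.mem_eigenspace_iff.mp (D.collectedBasis_mem _ i)
  let e := v₀.indexEquiv (Pi.basisFun ℂ (Fin n))
  let v := v₀.reindex e
  let μ : Fin n → ℂ := fun i => (e.symm i).1
  have hv : ∀ i, s (v i) = μ i • v i := fun i => by
    simp only [v, Module.Basis.reindex_apply]
    exact hv₀ _
  have hμ : ∀ i, μ i ≠ 0 := fun i h0 => by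
    have h1 := hv i
    rw [h0, zero_smul] at h1
    have hinj : Function.Injective s := ((Module.End.isUnit_iff s).1 hsu).1
    exact v.ne_zero i (hinj (by rw [h1, map_zero]))
  let Q : GL (Fin n) ℂ :=
    { val := (Pi.basisFun ℂ (Fin n)).toMatrix v
      inv := v.toMatrix (Pi.basisFun ℂ (Fin n))
      val_inv := Module.Basis.toMatrix_mul_toMatrix_flip _ _
      inv_val := Module.Basis.toMatrix_mul_toMatrix_flip _ _ }
  let c : Fin n → ℂˣ := fun i => Units.mk0 (μ i) (hμ i)
  have hS : LinearMap.toMatrix' s = conjDiagonal Q fun i => (c i : ℂ) := by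
    rw [← LinearMap.toMatrix'_toLin' (conjDiagonal Q fun i => (c i : ℂ))]
    congr 1
    refine v.ext fun j => ?_
    rw [hv, toLin'_apply, eq_comm, conjDiagonal_mulVec_eq_smul_iff]
    intro i
    have h1 : ((Q⁻¹ : GL (Fin n) ℂ) : Matrix (Fin n) (Fin n) ℂ) *ᵥ v j = v.repr (v j) :=
      Module.Basis.toMatrix_mulVec_repr (Pi.basisFun ℂ (Fin n)) v (v j)
    rw [h1, Module.Basis.repr_self, Finsupp.single_apply]
    by_cases hij : j = i
    · left; rw [hij]; rfl
    · right; rw [if_neg hij]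
  set S := conjDiagonal Q fun i => (c i : ℂ) with hSdef
  have hSi : S * conjDiagonal Q (fun i => ((c i)⁻¹ : ℂ)) = 1 := by
    rw [hSdef, conjDiagonal_mul, ← conjDiagonal_one Q]
    simp
  have hiS := mul_eq_one_comm.1 hSi
  set S' := conjDiagonal Q (fun i => ((c i)⁻¹ : ℂ))
  have hX : LinearMap.toMatrix' x = (A : Matrix (Fin n) (Fin n) ℂ) - S := by
    rw [← hS, ← LinearMap.toMatrix'_toLin' (A : Matrix (Fin n) (Fin n) ℂ), ← map_sub, ← hf, hxs,
      add_sub_cancel_right]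
  have hAS : Commute S (A : Matrix (Fin n) (Fin n) ℂ) := by
    have := hsf.map (LinearMap.toMatrixAlgEquiv' (R := ℂ) (n := Fin n))
    have h1 : LinearMap.toMatrixAlgEquiv' f = (A : Matrix (Fin n) (Fin n) ℂ) :=
      LinearMap.toMatrix'_toLin' _
    have h2 : LinearMap.toMatrixAlgEquiv' s = S := hS
    rwa [h1, h2] at this
  have hAS' : Commute S' (A : Matrix (Fin n) (Fin n) ℂ) := by
    have := hAS.eq
    calc S' * (A : Matrix (Fin n) (Fin n) ℂ) = S' * (A * S) * S' := by
          rw [Matrix.mul_assoc, Matrix.mul_assoc, hSi, Matrix.mul_one]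
      _ = A * S' := by rw [← this, ← Matrix.mul_assoc S', hiS, Matrix.one_mul]
  refine ⟨Q, c, S' * A, ⟨?_, ?_, ?_⟩⟩
  · have : S' * (A : Matrix (Fin n) (Fin n) ℂ) - 1 = S' * (A - S) := by
      rw [Matrix.mul_sub, hiS]
    rw [this, ← hX]
    refine Commute.isNilpotent_mul_left ?_ ?_
    · rw [hX]
      exact hAS'.sub_right (show S' * S = S * S' by rw [hSi, hiS])
    · exact hxn.map (LinearMap.toMatrixAlgEquiv' (R := ℂ) (n := Fin n))
  · exact Commute.mul_right (show S * S' = S' * S by rw [hSi, hiS]) hAS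
  · rw [← Matrix.mul_assoc, hSi, Matrix.one_mul]

/-- The eigenvectors of the semi-simple part of `A`, as the columns of a matrix. -/
def dunfordBasis {n : ℕ} (A : GL (Fin n) ℂ) : GL (Fin n) ℂ := (exists_isDunford A).choose

/-- The eigenvalues of the semi-simple part of `A`. -/
def dunfordEigenvalues {n : ℕ} (A : GL (Fin n) ℂ) : Fin n → ℂˣ :=
  (exists_isDunford A).choose_spec.choose

/-- The unipotent part of `A`. -/
def dunfordUnipotent {n : ℕ} (A : GL (Fin n) ℂ) : Matrix (Fin n) (Fin n) ℂ :=
  (exists_isDunford A).choose_spec.choose_spec.choose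

theorem isDunford_dunford {n : ℕ} (A : GL (Fin n) ℂ) :
    IsDunford (A : Matrix (Fin n) (Fin n) ℂ) (dunfordBasis A) (dunfordEigenvalues A)
      (dunfordUnipotent A) :=
  (exists_isDunford A).choose_spec.choose_spec.choose_spec

/-! ### The action of (γ, λ) on an object -/

/-- The matrix `γ(A_s) A_u^λ`. -/
def actionMatrix (g : ZAlg) {n : ℕ} (A : GL (Fin n) ℂ) : Matrix (Fin n) (Fin n) ℂ :=
  conjDiagonal (dunfordBasis A) (fun i => (g.1 (dunfordEigenvalues A i) : ℂ)) *
    binomialSum (Multiplicative.toAdd g.2) n (dunfordUnipotent A - 1)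

theorem actsAs_actionMatrix (g : ZAlg) {n : ℕ} (A : GL (Fin n) ℂ) :
    ActsAs g (A : Matrix (Fin n) (Fin n) ℂ) (actionMatrix g A) :=
  (isDunford_dunford A).actsAs

theorem actsAs_one {n : ℕ} (A : Matrix (Fin n) (Fin n) ℂ) : ActsAs 1 A 1 := by
  intro c m v hv
  have := binomialSum_natCast_mulVec hv 0
  rw [Nat.cast_zero, pow_zero] at this
  simp [this]

theorem actionMatrix_mul (g h : ZAlg) {n : ℕ} (A : GL (Fin n) ℂ) :
    actionMatrix (g * h) A = actionMatrix g A * actionMatrix h A :=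
  (actsAs_actionMatrix _ A).unique A.isUnit ((actsAs_actionMatrix g A).mul (actsAs_actionMatrix h A))

theorem actionMatrix_one {n : ℕ} (A : GL (Fin n) ℂ) : actionMatrix 1 A = 1 :=
  (actsAs_actionMatrix _ A).unique A.isUnit (actsAs_one _)

/-- The invertible matrix `γ(A_s) A_u^λ`. -/
def action (g : ZAlg) {n : ℕ} (A : GL (Fin n) ℂ) : GL (Fin n) ℂ where
  val := actionMatrix g A
  inv := actionMatrix g⁻¹ A
  val_inv := by rw [← actionMatrix_mul, show g * g⁻¹ = 1 from mul_inv_cancel g, actionMatrix_one]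
  inv_val := by rw [← actionMatrix_mul, show g⁻¹ * g = 1 from inv_mul_cancel g, actionMatrix_one]

theorem isIncarnation_action (g : ZAlg) {n : ℕ} (A : GL (Fin n) ℂ) :
    IsIncarnation g A (action g A) :=
  ⟨dunfordBasis A, dunfordEigenvalues A, _, dunfordUnipotent A, rfl, (isDunford_dunford A).nilpotent,
    (isDunford_dunford A).commute, (isDunford_dunford A).eq_mul, rfl⟩

theorem actsAs_action (g : ZAlg) {n : ℕ} (A : GL (Fin n) ℂ) :
    ActsAs g (A : Matrix (Fin n) (Fin n) ℂ) (action g A : Matrix (Fin n) (Fin n) ℂ) :=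
  actsAs_actionMatrix g A

theorem ActsAs.eq_action {g : ZAlg} {n : ℕ} {A M : GL (Fin n) ℂ}
    (h : ActsAs g (A : Matrix (Fin n) (Fin n) ℂ) (M : Matrix (Fin n) (Fin n) ℂ)) :
    M = action g A :=
  Units.ext (h.unique A.isUnit (actsAs_action g A))

theorem action_mul (g h : ZAlg) {n : ℕ} (A : GL (Fin n) ℂ) :
    action (g * h) A = action g A * action h A :=
  Units.ext (actionMatrix_mul g h A)

/-! ### Polynomial functions -/

/-- The algebra of polynomial functions on `ℂ`. -/
def polynomialFunctions : Subalgebra ℂ (ℂ → ℂ) := Algebra.adjoin ℂ {id}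

theorem const_mem_polynomialFunctions (a : ℂ) : (fun _ => a) ∈ polynomialFunctions :=
  polynomialFunctions.algebraMap_mem a

theorem exists_polynomial_of_mem {f : ℂ → ℂ} (hf : f ∈ polynomialFunctions) :
    ∃ P : Polynomial ℂ, ∀ x, f x = P.eval x := by
  rw [polynomialFunctions, Algebra.adjoin_singleton_eq_range_aeval] at hf
  obtain ⟨P, rfl⟩ := hf
  refine ⟨P, fun x => ?_⟩
  simp

theorem polynomial_mem_polynomialFunctions (P : Polynomial ℂ) :
    (fun x => P.eval x) ∈ polynomialFunctions := by
  rw [polynomialFunctions, Algebra.adjoin_singleton_eq_range_aeval]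
  refine ⟨P, funext fun x => ?_⟩
  simp

/-- Identities in λ are reduced by this to λ = j ∈ ℕ, where A_u^λ is an ordinary power; the density
of ℤ in ℂ also comes from it. -/
theorem eq_zero_of_mem_polynomialFunctions {f : ℂ → ℂ} (hf : f ∈ polynomialFunctions)
    (h : ∀ j : ℕ, f j = 0) (x : ℂ) : f x = 0 := by
  obtain ⟨P, hP⟩ := exists_polynomial_of_mem hf
  have : P = 0 := Polynomial.eq_of_infinite_eval_eq P 0 <|
    (Set.infinite_range_of_injective (Nat.cast_injective (R := ℂ))).mono <| by
      rintro _ ⟨j, rfl⟩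
      simp [← hP, h]
  rw [hP, this, Polynomial.eval_zero]

theorem choose_mem_polynomialFunctions (k : ℕ) :
    (fun x : ℂ => Ring.choose x k) ∈ polynomialFunctions := by
  have : (fun x : ℂ => Ring.choose x k) = fun x =>
      (Polynomial.C ((k.factorial : ℂ)⁻¹) *
        (descPochhammer ℤ k).map (algebraMap ℤ ℂ)).eval x := by
    funext x
    rw [Ring.choose_eq_smul, Polynomial.eval_mul, Polynomial.eval_C, smul_eq_mul,
      Polynomial.eval_map_algebraMap, Polynomial.aeval_eq_smeval]
  rw [this]
  exact polynomial_mem_polynomialFunctions _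

theorem binomialSum_apply_mem_polynomialFunctions {n : ℕ} (N : Matrix (Fin n) (Fin n) ℂ) (m : ℕ)
    (i j : Fin n) : (fun x => binomialSum x m N i j) ∈ polynomialFunctions := by
  have : (fun x => binomialSum x m N i j) = ∑ k ∈ Finset.range m,
      (fun x : ℂ => Ring.choose x k) * (fun _ => (N ^ k) i j) := by
    funext x
    simp [binomialSum, Matrix.sum_apply]
  rw [this]
  exact sum_mem fun k _ => mul_mem (choose_mem_polynomialFunctions k)
    (const_mem_polynomialFunctions _)

theorem binomialSum_mulVec_apply_mem_polynomialFunctions {n : ℕ} (N : Matrix (Fin n) (Fin n) ℂ)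
    (m : ℕ) (v : Fin n → ℂ) (i : Fin n) :
    (fun x => (binomialSum x m N *ᵥ v) i) ∈ polynomialFunctions := by
  have : (fun x => (binomialSum x m N *ᵥ v) i) = ∑ j,
      (fun x : ℂ => binomialSum x m N i j) * (fun _ => v j) := by
    funext x
    simp [mulVec, dotProduct]
  rw [this]
  exact sum_mem fun j _ => mul_mem (binomialSum_apply_mem_polynomialFunctions N m i j)
    (const_mem_polynomialFunctions _)

/-! ### Compatibility with tensor products -/

/-- The Kronecker product of matrices, indexed by `Fin (m * n)`. -/
def finKronecker {m n : ℕ} (A : Matrix (Fin m) (Fin m) ℂ) (B : Matrix (Fin n) (Fin n) ℂ) :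
    Matrix (Fin (m * n)) (Fin (m * n)) ℂ :=
  Matrix.reindexAlgEquiv ℂ ℂ (finProdFinEquiv (m := m) (n := n)) (A ⊗ₖ B)

/-- The tensor product of vectors, indexed by `Fin (m * n)`. -/
def tensorVec {m n : ℕ} (v : Fin m → ℂ) (w : Fin n → ℂ) : Fin (m * n) → ℂ :=
  fun i => v (finProdFinEquiv.symm i).1 * w (finProdFinEquiv.symm i).2

theorem glTensor_val {m n : ℕ} (A : GL (Fin m) ℂ) (B : GL (Fin n) ℂ) :
    (glTensor A B : Matrix (Fin (m * n)) (Fin (m * n)) ℂ) = finKronecker A.val B.val :=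
  rfl

theorem finKronecker_mul {m n : ℕ} (A A' : Matrix (Fin m) (Fin m) ℂ)
    (B B' : Matrix (Fin n) (Fin n) ℂ) :
    finKronecker (A * A') (B * B') = finKronecker A B * finKronecker A' B' := by
  rw [finKronecker, mul_kronecker_mul, map_mul]; rfl

theorem finKronecker_one_one {m n : ℕ} :
    finKronecker (1 : Matrix (Fin m) (Fin m) ℂ) (1 : Matrix (Fin n) (Fin n) ℂ) = 1 := by
  rw [finKronecker, one_kronecker_one, map_one]

theorem finKronecker_add {m n : ℕ} (A : Matrix (Fin m) (Fin m) ℂ)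
    (B B' : Matrix (Fin n) (Fin n) ℂ) :
    finKronecker A (B + B') = finKronecker A B + finKronecker A B' := by
  rw [finKronecker, kronecker_add, map_add]; rfl

theorem add_finKronecker {m n : ℕ} (A A' : Matrix (Fin m) (Fin m) ℂ)
    (B : Matrix (Fin n) (Fin n) ℂ) :
    finKronecker (A + A') B = finKronecker A B + finKronecker A' B := by
  rw [finKronecker, add_kronecker, map_add]; rfl

theorem smul_finKronecker_smul {m n : ℕ} (a b : ℂ) (A : Matrix (Fin m) (Fin m) ℂ)
    (B : Matrix (Fin n) (Fin n) ℂ) :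
    finKronecker (a • A) (b • B) = (a * b) • finKronecker A B := by
  rw [finKronecker, smul_kronecker, kronecker_smul, smul_smul, map_smul]; rfl

theorem finKronecker_pow {m n : ℕ} (A : Matrix (Fin m) (Fin m) ℂ) (B : Matrix (Fin n) (Fin n) ℂ)
    (k : ℕ) : finKronecker A B ^ k = finKronecker (A ^ k) (B ^ k) := by
  induction k with
  | zero => simp [finKronecker_one_one]
  | succ k ih => rw [pow_succ, ih, ← finKronecker_mul, pow_succ, pow_succ]

theorem finKronecker_mulVec {m n : ℕ} (A : Matrix (Fin m) (Fin m) ℂ)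
    (B : Matrix (Fin n) (Fin n) ℂ) (v : Fin m → ℂ) (w : Fin n → ℂ) :
    finKronecker A B *ᵥ tensorVec v w = tensorVec (A *ᵥ v) (B *ᵥ w) := by
  ext i
  simp only [mulVec, dotProduct, tensorVec, finKronecker]
  rw [Finset.sum_mul_sum, ← Finset.sum_product', ← finProdFinEquiv.sum_comp]
  simp only [Equiv.symm_apply_apply, Finset.univ_product_univ]
  refine Finset.sum_congr rfl fun x _ => ?_
  simp [kroneckerMap_apply]
  ring

theorem tensorVec_zero {m n : ℕ} (v : Fin m → ℂ) : tensorVec v (0 : Fin n → ℂ) = 0 := by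
  ext i; simp [tensorVec]

theorem zero_tensorVec {m n : ℕ} (w : Fin n → ℂ) : tensorVec (0 : Fin m → ℂ) w = 0 := by
  ext i; simp [tensorVec]

theorem smul_tensorVec_smul {m n : ℕ} (a b : ℂ) (v : Fin m → ℂ) (w : Fin n → ℂ) :
    tensorVec (a • v) (b • w) = (a * b) • tensorVec v w := by
  ext i; simp [tensorVec]; ring

/-- `tensorVec` as a bilinear map. -/
def tensorVecₗ (m n : ℕ) : (Fin m → ℂ) →ₗ[ℂ] (Fin n → ℂ) →ₗ[ℂ] (Fin (m * n) → ℂ) :=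
  LinearMap.mk₂ ℂ tensorVec (fun _ _ _ => by ext; simp [tensorVec, add_mul])
    (fun _ _ _ => by ext; simp [tensorVec, mul_assoc])
    (fun _ _ _ => by ext; simp [tensorVec, mul_add])
    (fun _ _ _ => by ext; simp [tensorVec, mul_left_comm])

/-- (1 + N) ⊗ (1 + N') - 1 is the sum of the commuting matrices N ⊗ (1 + N') and 1 ⊗ N'. -/
theorem nilpotentPart_finKronecker_pow_mulVec {m n : ℕ} {N : Matrix (Fin m) (Fin m) ℂ}
    {N' : Matrix (Fin n) (Fin n) ℂ} {v : Fin m → ℂ} {w : Fin n → ℂ} {a b : ℕ}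
    (hv : N ^ a *ᵥ v = 0) (hw : N' ^ b *ᵥ w = 0) :
    (finKronecker (1 + N) (1 + N') - 1) ^ (a + b) *ᵥ tensorVec v w = 0 := by
  have : finKronecker (1 + N) (1 + N') - 1 = finKronecker N (1 + N') + finKronecker 1 N' := by
    rw [add_finKronecker, finKronecker_add (1 : Matrix (Fin m) (Fin m) ℂ), finKronecker_one_one]
    abel
  rw [this]
  refine pow_add_mulVec_eq_zero ?_ ?_ ?_
  · change _ * _ = _ * _
    rw [← finKronecker_mul, ← finKronecker_mul, Matrix.mul_one, Matrix.one_mul, Matrix.add_mul,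
      Matrix.mul_add, Matrix.one_mul, Matrix.mul_one]
  · rw [finKronecker_pow, finKronecker_mulVec, hv, zero_tensorVec]
  · rw [finKronecker_pow, finKronecker_mulVec, hw, tensorVec_zero]

/-- Each coordinate of either side is polynomial in `x`, and at a natural number `j` both sides are
the `j`-th power of a Kronecker product applied to v ⊗ w. -/
theorem binomialSum_finKronecker_mulVec {m n : ℕ} {N : Matrix (Fin m) (Fin m) ℂ}
    {N' : Matrix (Fin n) (Fin n) ℂ} {v : Fin m → ℂ} {w : Fin n → ℂ} {a b : ℕ}
    (hv : N ^ a *ᵥ v = 0) (hw : N' ^ b *ᵥ w = 0) (x : ℂ) :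
    binomialSum x (a + b) (finKronecker (1 + N) (1 + N') - 1) *ᵥ tensorVec v w =
      tensorVec (binomialSum x a N *ᵥ v) (binomialSum x b N' *ᵥ w) := by
  ext i
  rw [← sub_eq_zero]
  refine eq_zero_of_mem_polynomialFunctions
    (f := fun x => (binomialSum x (a + b) (finKronecker (1 + N) (1 + N') - 1) *ᵥ tensorVec v w) i -
      tensorVec (binomialSum x a N *ᵥ v) (binomialSum x b N' *ᵥ w) i) ?_ (fun j => ?_) x
  · exact sub_mem (binomialSum_mulVec_apply_mem_polynomialFunctions _ _ _ _)
      (mul_mem (binomialSum_mulVec_apply_mem_polynomialFunctions _ _ _ _)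
        (binomialSum_mulVec_apply_mem_polynomialFunctions _ _ _ _))
  · rw [binomialSum_natCast_mulVec (nilpotentPart_finKronecker_pow_mulVec hv hw),
      binomialSum_natCast_mulVec hv, binomialSum_natCast_mulVec hw, add_sub_cancel,
      finKronecker_pow, finKronecker_mulVec, sub_self]

theorem eq_of_forall_mulVec_tensorVec {m n p : ℕ} {Z Z' : Matrix (Fin p) (Fin (m * n)) ℂ}
    (h : ∀ v w, Z *ᵥ tensorVec v w = Z' *ᵥ tensorVec v w) : Z = Z' := by
  refine Matrix.toLin'.injective ((Pi.basisFun ℂ _).ext fun i => ?_)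
  have : Pi.basisFun ℂ (Fin (m * n)) i = tensorVec (Pi.single (finProdFinEquiv.symm i).1 1)
      (Pi.single (finProdFinEquiv.symm i).2 1) := by
    ext k
    simp only [Pi.basisFun_apply, tensorVec, Pi.single_apply, ← ite_and, mul_ite, mul_one, mul_zero]
    congr 1
    rw [← finProdFinEquiv.symm.injective.eq_iff, Prod.ext_iff, and_comm]
  rw [this]
  exact h _ _

theorem eq_of_forall_tensorVec {m n : ℕ} {A : Matrix (Fin m) (Fin m) ℂ}
    {B : Matrix (Fin n) (Fin n) ℂ} (hA : IsUnit A) (hB : IsUnit B)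
    {Z Z' : Matrix (Fin (m * n)) (Fin (m * n)) ℂ}
    (h : ∀ (c d : ℂˣ) (a b : ℕ) (v : Fin m → ℂ) (w : Fin n → ℂ), nilpotentPart A c ^ a *ᵥ v = 0 →
      nilpotentPart B d ^ b *ᵥ w = 0 → Z *ᵥ tensorVec v w = Z' *ᵥ tensorVec v w) : Z = Z' := by
  have h1 : ∀ (d : ℂˣ) (b : ℕ) (w : Fin n → ℂ), nilpotentPart B d ^ b *ᵥ w = 0 →
      ∀ v, Z *ᵥ tensorVec v w = Z' *ᵥ tensorVec v w := by
    intro d b w hw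
    have := eq_top_of_generalizedEigenvectors hA
      (LinearMap.eqLocus ((toLin' Z).comp ((tensorVecₗ m n).flip w))
        ((toLin' Z').comp ((tensorVecₗ m n).flip w))) (fun c a v hv => h c d a b v w hv hw)
    intro v
    exact LinearMap.congr_fun (LinearMap.eqLocus_eq_top.1 this) v
  have h2 : ∀ v w, Z *ᵥ tensorVec v w = Z' *ᵥ tensorVec v w := by
    intro v w
    have := eq_top_of_generalizedEigenvectors hB
      (LinearMap.eqLocus ((toLin' Z).comp (tensorVecₗ m n v))
        ((toLin' Z').comp (tensorVecₗ m n v))) (fun d b w hw => h1 d b w hw v)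
    exact LinearMap.congr_fun (LinearMap.eqLocus_eq_top.1 this) w
  exact eq_of_forall_mulVec_tensorVec h2

theorem nilpotentPart_finKronecker {m n : ℕ} (A : Matrix (Fin m) (Fin m) ℂ)
    (B : Matrix (Fin n) (Fin n) ℂ) (c d : ℂˣ) :
    nilpotentPart (finKronecker A B) (c * d) =
      finKronecker (1 + nilpotentPart A c) (1 + nilpotentPart B d) - 1 := by
  rw [nilpotentPart, nilpotentPart, nilpotentPart, add_sub_cancel, add_sub_cancel,
    smul_finKronecker_smul, mul_inv, Units.val_mul]

/-- If `v` and `w` are generalized eigenvectors for `c` and `d`, then v ⊗ w is one for `c * d`;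
multiplicativity of γ handles the scalars. -/
theorem action_glTensor (g : ZAlg) {m n : ℕ} (A : GL (Fin m) ℂ) (B : GL (Fin n) ℂ) :
    action g (glTensor A B) = glTensor (action g A) (action g B) := by
  refine Units.ext (eq_of_forall_tensorVec A.isUnit B.isUnit fun c d a b v w hv hw => ?_)
  rw [glTensor_val (action g A), finKronecker_mulVec, actsAs_action g A c a v hv,
    actsAs_action g B d b w hw, smul_tensorVec_smul,
    actsAs_action g (glTensor A B) (c * d) (a + b) _ ?_, glTensor_val, nilpotentPart_finKronecker,
    binomialSum_finKronecker_mulVec hv hw, map_mul, Units.val_mul]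
  rw [glTensor_val, nilpotentPart_finKronecker]
  exact nilpotentPart_finKronecker_pow_mulVec hv hw

/-! ### Morphisms of flat objects -/

theorem eq_zero_of_eventually_hasSum_zero {a : ℕ → ℂ}
    (h : ∀ᶠ z : ℂ in 𝓝 0, HasSum (fun k => z ^ k * a k) 0) (k : ℕ) : a k = 0 := by
  have h1 : HasFPowerSeriesAt (fun _ : ℂ => (0 : ℂ)) (FormalMultilinearSeries.ofScalars ℂ a) 0 := by
    rw [hasFPowerSeriesAt_iff]
    simpa using h
  have h2 := h1.eq_zero
  rw [← FormalMultilinearSeries.coeff_ofScalars (𝕜 := ℂ) (p := a) (n := k), h2]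
  simp [FormalMultilinearSeries.coeff]

theorem exists_coeff_of_analyticAt {n p : ℕ} {A : Matrix (Fin n) (Fin n) ℂ}
    {B : Matrix (Fin p) (Fin p) ℂ} {G : ℂ → Matrix (Fin p) (Fin n) ℂ}
    (hG : ∀ i j, AnalyticAt ℂ (fun z => G z i j) 0) (q d : ℂ)
    (h : ∀ᶠ z in 𝓝[≠] (0 : ℂ), G (q * z) * A = d • (B * G z)) :
    ∃ C : ℕ → Matrix (Fin p) (Fin n) ℂ,
      (∀ᶠ z in 𝓝 (0 : ℂ), ∀ i j, HasSum (fun k => z ^ k * C k i j) (G z i j)) ∧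
      ∀ k, q ^ k • (C k * A) = d • (B * C k) := by
  choose P hP using hG
  let C : ℕ → Matrix (Fin p) (Fin n) ℂ := fun k i j => (P i j).coeff k
  have hC : ∀ᶠ z in 𝓝 (0 : ℂ), ∀ i j, HasSum (fun k => z ^ k * C k i j) (G z i j) := by
    simp only [eventually_all]
    intro i j
    have := hasFPowerSeriesAt_iff.1 (hP i j)
    simpa using this
  refine ⟨C, hC, fun k => ?_⟩
  have hq : Tendsto (fun z : ℂ => q * z) (𝓝 0) (𝓝 0) := by
    have : Continuous fun z : ℂ => q * z := by fun_prop
    simpa using this.tendsto 0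
  have hCq := hq.eventually hC
  ext i l
  -- The equation is only known off 0; analyticity of the difference extends it to a full
  -- neighbourhood, as comparing power series requires.
  have hlim : ∀ᶠ z in 𝓝 (0 : ℂ), (G (q * z) * A) i l - (d • (B * G z)) i l = 0 := by
    have hGq : ∀ i j, AnalyticAt ℂ (fun z => G (q * z) i j) 0 := by
      intro i j
      have h1 : AnalyticAt ℂ (fun z => G z i j) (q * 0) := by rw [mul_zero]; exact ⟨_, hP i j⟩
      exact AnalyticAt.fun_comp (g := fun z => G z i j) (f := fun z => q * z) h1 (by fun_prop)
    have han : AnalyticAt ℂ (fun z => (G (q * z) * A) i l - (d • (B * G z)) i l) 0 := by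
      simp only [Matrix.mul_apply, Matrix.smul_apply, smul_eq_mul]
      have hG' : ∀ i j, AnalyticAt ℂ (fun z => G z i j) 0 := fun i j => ⟨_, hP i j⟩
      refine AnalyticAt.sub (Finset.analyticAt_fun_sum _ fun j _ => ?_) (analyticAt_const.mul ?_)
      · exact (hGq i j).mul analyticAt_const
      · exact Finset.analyticAt_fun_sum _ fun j _ => analyticAt_const.mul (hG' j l)
    refine han.frequently_zero_iff_eventually_zero.1 (Eventually.frequently ?_)
    filter_upwards [h] with z hz
    rw [hz, sub_self]
  rw [← sub_eq_zero]
  refine eq_zero_of_eventually_hasSum_zero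
    (a := fun k => (q ^ k • (C k * A)) i l - (d • (B * C k)) i l) ?_ k
  filter_upwards [hC, hCq, hlim] with z h1 h2 h3
  rw [← h3]
  simp only [Matrix.mul_apply, Matrix.smul_apply, smul_eq_mul]
  have hs := (hasSum_sum (s := Finset.univ) fun j _ => (h2 i j).mul_right (A j l)).sub
    ((hasSum_sum (s := Finset.univ) fun j _ => (h1 j l).mul_left (B i j)).mul_left d)
  refine (congrArg (fun f => HasSum f _) (funext fun k => ?_)).mpr hs
  simp only [mul_sub, Finset.mul_sum]
  congr 1
  · exact Finset.sum_congr rfl fun j _ => by ring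
  · exact Finset.sum_congr rfl fun j _ => by ring

theorem exists_analyticAt_pow_mul {n p : ℕ} {F : ℂ → Matrix (Fin p) (Fin n) ℂ}
    (hF : ∀ i j, MeromorphicAt (fun z => F z i j) 0) :
    ∃ d : ℕ, ∀ i j, AnalyticAt ℂ (fun z => (z ^ d • F z) i j) 0 := by
  choose D hD using hF
  refine ⟨∑ i, ∑ j, D i j, fun i j => ?_⟩
  have hle : D i j ≤ ∑ i, ∑ j, D i j :=
    (Finset.single_le_sum (f := fun j => D i j) (fun _ _ => Nat.zero_le _) (Finset.mem_univ j)).trans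
      (Finset.single_le_sum (f := fun i => ∑ j, D i j) (fun _ _ => Nat.zero_le _)
        (Finset.mem_univ i))
  obtain ⟨e, he⟩ := Nat.exists_eq_add_of_le' hle
  rw [he]
  have : (fun z => (z ^ (e + D i j) • F z) i j) = fun z => z ^ e * ((z - 0) ^ D i j • F z i j) := by
    funext z
    simp [pow_add, mul_assoc]
  rw [this]
  exact AnalyticAt.mul (by fun_prop) (hD i j)

theorem FlatHom.eventually_equivariant {q : ℂˣ} {X Y : FlatObj} (F : FlatHom q X Y) (w : ℂ) :
    ∀ᶠ z in 𝓝[≠] w, F.toFun (q * z) * (X.mat : Matrix (Fin X.rank) (Fin X.rank) ℂ) =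
      (Y.mat : Matrix (Fin Y.rank) (Fin Y.rank) ℂ) * F.toFun z := by
  have := mem_codiscrete.1 F.equivariant w
  rw [disjoint_principal_right, compl_compl] at this
  exact this

theorem FlatHom.eventually_mul_action {q : ℂˣ} {X Y : FlatObj} (F : FlatHom q X Y) {g : ZAlg}
    (hg : g.1 q = 1) :
    ∀ᶠ z in 𝓝[≠] (0 : ℂ), F.toFun z * (action g X.mat : Matrix (Fin X.rank) (Fin X.rank) ℂ) =
      (action g Y.mat : Matrix (Fin Y.rank) (Fin Y.rank) ℂ) * F.toFun z := by
  obtain ⟨d, hd⟩ := exists_analyticAt_pow_mul fun i j =>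
    (F.meromorphic i j (Set.mem_univ 0)).meromorphicAt
  obtain ⟨C, hC, hCk⟩ := exists_coeff_of_analyticAt
    (A := (X.mat : Matrix (Fin X.rank) (Fin X.rank) ℂ))
    (B := (Y.mat : Matrix (Fin Y.rank) (Fin Y.rank) ℂ)) hd (q : ℂ) ((q : ℂ) ^ d) (by
      filter_upwards [F.eventually_equivariant 0] with z hz
      rw [Matrix.smul_mul, hz, Matrix.mul_smul, smul_smul, mul_pow])
  have hCM : ∀ k, C k * (action g X.mat : Matrix (Fin X.rank) (Fin X.rank) ℂ) =
      (action g Y.mat : Matrix (Fin Y.rank) (Fin Y.rank) ℂ) * C k := by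
    intro k
    -- The twist is q^(k - d): `C k` is the Laurent coefficient of `F` of index k - d.
    refine (actsAs_action g X.mat).intertwines X.mat.isUnit (actsAs_action g Y.mat)
      (d := (q ^ d)⁻¹ * q ^ k) (by simp [hg]) ?_
    rw [Units.val_mul, mul_smul, Units.val_pow_eq_pow_val, hCk, smul_smul,
      ← Units.val_pow_eq_pow_val, Units.inv_mul, one_smul]
  filter_upwards [nhdsWithin_le_nhds hC, self_mem_nhdsWithin] with z hz hz0
  have hz0' : z ^ d ≠ 0 := pow_ne_zero _ hz0
  have : z ^ d • (F.toFun z * (action g X.mat : Matrix (Fin X.rank) (Fin X.rank) ℂ)) =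
      z ^ d • ((action g Y.mat : Matrix (Fin Y.rank) (Fin Y.rank) ℂ) * F.toFun z) := by
    rw [← Matrix.smul_mul, ← Matrix.mul_smul]
    ext i l
    have h1 := hasSum_sum (s := Finset.univ) fun j _ =>
      (hz i j).mul_right ((action g X.mat : Matrix (Fin X.rank) (Fin X.rank) ℂ) j l)
    have h2 := hasSum_sum (s := Finset.univ) fun j _ =>
      (hz j l).mul_left ((action g Y.mat : Matrix (Fin Y.rank) (Fin Y.rank) ℂ) i j)
    rw [Matrix.mul_apply, Matrix.mul_apply]
    refine h1.unique ?_
    convert h2 using 2 with k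
    have := congr_fun (congr_fun (hCM k) i) l
    rw [Matrix.mul_apply, Matrix.mul_apply] at this
    simp only [mul_assoc, mul_left_comm _ (z ^ k), ← Finset.mul_sum, this]
  exact smul_right_injective _ hz0' this

/-- Near `q * w` the functional equation expresses `F` through its values near `w`, up to the point
itself; the normal form convention then forces the value there to be the analytic one. -/
theorem FlatHom.analyticAt_mul {q : ℂˣ} {X Y : FlatObj} (F : FlatHom q X Y) {w : ℂ}
    (hw : ∀ i j, AnalyticAt ℂ (fun z => F.toFun z i j) w) :
    (∀ i j, AnalyticAt ℂ (fun z => F.toFun z i j) (q * w)) ∧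
      F.toFun (q * w) = (Y.mat : Matrix (Fin Y.rank) (Fin Y.rank) ℂ) * F.toFun w *
        ((X.mat⁻¹ : GL (Fin X.rank) ℂ) : Matrix (Fin X.rank) (Fin X.rank) ℂ) := by
  let H : ℂ → Matrix (Fin Y.rank) (Fin X.rank) ℂ := fun u =>
    (Y.mat : Matrix (Fin Y.rank) (Fin Y.rank) ℂ) * F.toFun (((q⁻¹ : ℂˣ) : ℂ) * u) *
      ((X.mat⁻¹ : GL (Fin X.rank) ℂ) : Matrix (Fin X.rank) (Fin X.rank) ℂ)
  have hqw : ((q⁻¹ : ℂˣ) : ℂ) * (q * w) = w := Units.inv_mul_cancel_left q w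
  have hFq : ∀ i j, AnalyticAt ℂ (fun u => F.toFun (((q⁻¹ : ℂˣ) : ℂ) * u) i j) (q * w) := by
    intro i j
    refine AnalyticAt.fun_comp (g := fun z => F.toFun z i j) (f := fun u => ((q⁻¹ : ℂˣ) : ℂ) * u)
      ?_ (by fun_prop)
    simp only [hqw]
    exact hw i j
  have hH : ∀ i j, AnalyticAt ℂ (fun u => H u i j) (q * w) := by
    intro i j
    simp only [H, Matrix.mul_apply]
    exact Finset.analyticAt_fun_sum _ fun k _ => AnalyticAt.mul
      (Finset.analyticAt_fun_sum _ fun l _ => analyticAt_const.mul (hFq l k)) analyticAt_const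
  have ht : Tendsto (fun u => ((q⁻¹ : ℂˣ) : ℂ) * u) (𝓝[≠] ((q : ℂ) * w)) (𝓝[≠] w) := by
    refine tendsto_nhdsWithin_iff.2 ⟨?_, ?_⟩
    · have : Continuous fun u => ((q⁻¹ : ℂˣ) : ℂ) * u := by fun_prop
      have h := this.tendsto ((q : ℂ) * w)
      rw [hqw] at h
      exact h.mono_left nhdsWithin_le_nhds
    · filter_upwards [self_mem_nhdsWithin] with u hu hu'
      exact hu (by rw [← Set.mem_singleton_iff.1 hu']; exact (Units.mul_inv_cancel_left q u).symm)
  have hev : ∀ᶠ u in 𝓝[≠] ((q : ℂ) * w), F.toFun u = H u := by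
    filter_upwards [ht.eventually (F.eventually_equivariant w)] with u hu
    rw [Units.mul_inv_cancel_left] at hu
    simp only [H]
    rw [← hu, Matrix.mul_assoc, Units.mul_inv, Matrix.mul_one]
  have hnhds : ∀ i j, (fun u => F.toFun u i j) =ᶠ[𝓝 ((q : ℂ) * w)] fun u => H u i j := by
    intro i j
    rw [← (F.meromorphic i j (Set.mem_univ _)).eventuallyEq_nhdsNE_iff_eventuallyEq_nhds
      (hH i j).meromorphicNFAt]
    filter_upwards [hev] with u hu
    rw [hu]
  refine ⟨fun i j => (hH i j).congr (hnhds i j).symm, ?_⟩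
  ext i j
  have := (hnhds i j).eq_of_nhds
  simp only [H, hqw] at this
  exact this

theorem action_commute_self (g : ZAlg) {n : ℕ} (A : GL (Fin n) ℂ) : Commute (action g A) A := by
  refine (Units.ext ?_ : A * action g A = action g A * A).symm
  exact (actsAs_action g A).intertwines A.isUnit (actsAs_action g A) (d := 1) (map_one _)
    (by rw [Units.val_one, one_smul])

theorem FlatHom.mul_action {q : ℂˣ} (hq : 1 < ‖(q : ℂ)‖) {X Y : FlatObj} (F : FlatHom q X Y)
    {g : ZAlg} (hg : g.1 q = 1) (z : ℂˣ) :
    F.toFun z * (action g X.mat : Matrix (Fin X.rank) (Fin X.rank) ℂ) =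
      (action g Y.mat : Matrix (Fin Y.rank) (Fin Y.rank) ℂ) * F.toFun z := by
  have hev : ∀ᶠ w in 𝓝[≠] (0 : ℂ), (∀ i j, AnalyticAt ℂ (fun z => F.toFun z i j) w) ∧
      F.toFun w * (action g X.mat : Matrix (Fin X.rank) (Fin X.rank) ℂ) =
        (action g Y.mat : Matrix (Fin Y.rank) (Fin Y.rank) ℂ) * F.toFun w := by
    refine Filter.Eventually.and ?_ (F.eventually_mul_action hg)
    simp only [eventually_all]
    exact fun i j => (F.meromorphic i j (Set.mem_univ 0)).meromorphicAt.eventually_analyticAt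
  -- Since |q| > 1, the points q⁻ᵏ z tend to 0, so one of them lies where `F` is analytic and
  -- intertwines the actions.
  have ht : Tendsto (fun k : ℕ => ((q⁻¹ : ℂˣ) : ℂ) ^ k * z) atTop (𝓝[≠] (0 : ℂ)) := by
    refine tendsto_nhdsWithin_iff.2 ⟨?_, Eventually.of_forall fun k => ?_⟩
    · have : ‖((q⁻¹ : ℂˣ) : ℂ)‖ < 1 := by
        rw [Units.val_inv_eq_inv_val, norm_inv]
        exact inv_lt_one_of_one_lt₀ hq
      simpa using (tendsto_pow_atTop_nhds_zero_of_norm_lt_one this).mul_const (z : ℂ)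
    · exact mul_ne_zero (pow_ne_zero _ (Units.ne_zero _)) z.ne_zero
  obtain ⟨k, hk⟩ := (ht.eventually hev).exists
  -- Multiplication by `q` preserves both properties: F(qw) = B F(w) A⁻¹, and the actions commute
  -- with `A` and `B`.
  have key : ∀ l : ℕ, ∀ w : ℂ, (∀ i j, AnalyticAt ℂ (fun z => F.toFun z i j) w) ∧
      F.toFun w * (action g X.mat : Matrix (Fin X.rank) (Fin X.rank) ℂ) =
        (action g Y.mat : Matrix (Fin Y.rank) (Fin Y.rank) ℂ) * F.toFun w →
      F.toFun ((q : ℂ) ^ l * w) * (action g X.mat : Matrix (Fin X.rank) (Fin X.rank) ℂ) =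
        (action g Y.mat : Matrix (Fin Y.rank) (Fin Y.rank) ℂ) * F.toFun ((q : ℂ) ^ l * w) := by
    intro l
    induction l with
    | zero => intro w hw; simpa using hw.2
    | succ l ih =>
      intro w hw
      obtain ⟨h1, h2⟩ := F.analyticAt_mul hw.1
      have hX := congr_arg Units.val (action_commute_self g X.mat).inv_right.eq
      have hY := congr_arg Units.val (action_commute_self g Y.mat).eq
      rw [Units.val_mul, Units.val_mul] at hX hY
      have := ih (q * w) ⟨h1, by
        rw [h2, Matrix.mul_assoc, ← hX, ← Matrix.mul_assoc, Matrix.mul_assoc _ (F.toFun w), hw.2,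
          ← Matrix.mul_assoc, ← Matrix.mul_assoc, ← Matrix.mul_assoc, hY]⟩
      rwa [← mul_assoc, ← pow_succ] at this
  have := key k _ hk
  rwa [← mul_assoc, ← mul_pow, Units.mul_inv, one_pow, one_mul] at this

theorem actsAs_smul_one (g : ZAlg) {n : ℕ} (a : ℂˣ) :
    ActsAs g ((a : ℂ) • (1 : Matrix (Fin n) (Fin n) ℂ)) ((g.1 a : ℂ) • 1) := by
  intro c m v hv
  have hN : nilpotentPart ((a : ℂ) • (1 : Matrix (Fin n) (Fin n) ℂ)) c =
      (((c⁻¹ * a : ℂˣ) : ℂ) - 1) • 1 := by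
    rw [nilpotentPart, smul_smul, sub_smul, one_smul, Units.val_mul]
  rw [hN] at hv ⊢
  have hv0 : c ≠ a → v = 0 := by
    intro hca
    have h1 : ((c⁻¹ * a : ℂˣ) : ℂ) - 1 ≠ 0 := by
      rw [sub_ne_zero, Ne, Units.val_eq_one, inv_mul_eq_one]
      exact hca
    rw [smul_pow, one_pow, smul_mulVec, one_mulVec] at hv
    exact (smul_eq_zero.1 hv).resolve_left (pow_ne_zero _ h1)
  by_cases hca : c = a
  · subst hca
    rw [smul_mulVec, one_mulVec, inv_mul_cancel, Units.val_one, sub_self, zero_smul] at *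
    cases m with
    | zero =>
      rw [pow_zero, one_mulVec] at hv
      simp [hv]
    | succ m => simp [binomialSum, Finset.sum_range_succ']
  · rw [hv0 hca, mulVec_zero, mulVec_zero, smul_zero]

theorem action_one_matrix (g : ZAlg) {n : ℕ} : action g (1 : GL (Fin n) ℂ) = 1 := by
  refine (ActsAs.eq_action ?_).symm
  simpa using actsAs_smul_one g (n := n) 1

/-- The element of the local Galois group defined by `(γ, λ)` with `γ(q) = 1`. -/
def toLocalGaloisGroup {q : ℂˣ} (hq : 1 < ‖(q : ℂ)‖) (z₀ : ℂˣ) :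
    evalKer q →* localGaloisGroup q z₀ where
  toFun g := ⟨fun X => action (g : ZAlg) X.mat,
    fun _ _ F => F.mul_action hq g.2 z₀,
    fun X Y => action_glTensor _ X.mat Y.mat,
    action_one_matrix _⟩
  map_one' := Subtype.ext <| funext fun X => Units.ext (actionMatrix_one X.mat)
  map_mul' _ _ := Subtype.ext <| funext fun X => action_mul _ _ X.mat

/-! ### Injectivity and surjectivity -/

/-- A matrix intertwining `A` and `B`, as a morphism of flat objects. -/
def FlatHom.const (q : ℂˣ) {X Y : FlatObj} (F : Matrix (Fin Y.rank) (Fin X.rank) ℂ)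
    (h : F * (X.mat : Matrix (Fin X.rank) (Fin X.rank) ℂ) =
      (Y.mat : Matrix (Fin Y.rank) (Fin Y.rank) ℂ) * F) : FlatHom q X Y where
  toFun _ := F
  meromorphic _ _ := AnalyticOnNhd.meromorphicNFOn analyticOnNhd_const
  equivariant := Filter.Eventually.of_forall fun _ => h

/-- The scalar matrix `c`. -/
def scalarGL (n : ℕ) : ℂˣ →* GL (Fin n) ℂ :=
  Units.map (algebraMap ℂ (Matrix (Fin n) (Fin n) ℂ)).toMonoidHom

theorem scalarGL_val (n : ℕ) (c : ℂˣ) :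
    (scalarGL n c : Matrix (Fin n) (Fin n) ℂ) = (c : ℂ) • 1 :=
  Algebra.algebraMap_eq_smul_one _

/-! ### Unipotent Jordan blocks -/

/-- The nilpotent Jordan block `e_k ↦ e_{k+1}`. -/
def shiftMatrix (m : ℕ) : Matrix (Fin m) (Fin m) ℂ :=
  Matrix.of fun i j => if (i : ℕ) = j + 1 then 1 else 0

/-- The vector `e_k`, which vanishes for `m ≤ k`. -/
def stdVec (m k : ℕ) : Fin m → ℂ := fun i => if (i : ℕ) = k then 1 else 0

theorem stdVec_eq_single {m : ℕ} (k : Fin m) : stdVec m k = Pi.single k 1 := by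
  ext i
  simp [stdVec, Pi.single_apply, Fin.ext_iff]

theorem stdVec_of_le {m k : ℕ} (h : m ≤ k) : stdVec m k = 0 := by
  ext i
  simp only [stdVec, Pi.zero_apply, ite_eq_right_iff, one_ne_zero, imp_false]
  omega

theorem shiftMatrix_mulVec_stdVec (m k : ℕ) :
    shiftMatrix m *ᵥ stdVec m k = stdVec m (k + 1) := by
  rcases le_or_gt m k with h | h
  · rw [stdVec_of_le h, stdVec_of_le (by omega), mulVec_zero]
  · lift k to Fin m using h
    rw [stdVec_eq_single, mulVec_single_one]
    ext i
    simp [shiftMatrix, stdVec]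

theorem shiftMatrix_pow_mulVec_stdVec (m k l : ℕ) :
    shiftMatrix m ^ l *ᵥ stdVec m k = stdVec m (k + l) := by
  induction l with
  | zero => simp
  | succ l ih => rw [pow_succ', ← mulVec_mulVec, ih, shiftMatrix_mulVec_stdVec, add_assoc]

theorem eq_of_forall_stdVec {m p : ℕ} {M M' : Matrix (Fin p) (Fin m) ℂ}
    (h : ∀ k < m, M *ᵥ stdVec m k = M' *ᵥ stdVec m k) : M = M' := by
  refine Matrix.toLin'.injective ((Pi.basisFun ℂ _).ext fun k => ?_)
  rw [Pi.basisFun_apply, ← stdVec_eq_single]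
  exact h k k.2

theorem shiftMatrix_pow_self (m : ℕ) : shiftMatrix m ^ m = 0 :=
  eq_of_forall_stdVec fun k _ => by
    rw [shiftMatrix_pow_mulVec_stdVec, stdVec_of_le (by omega), zero_mulVec]

/-- The unipotent Jordan block. -/
def jordanGL (m : ℕ) : GL (Fin m) ℂ :=
  (IsNilpotent.isUnit_one_add ⟨m, shiftMatrix_pow_self m⟩ : IsUnit (1 + shiftMatrix m)).unit

theorem jordanGL_val (m : ℕ) :
    (jordanGL m : Matrix (Fin m) (Fin m) ℂ) = 1 + shiftMatrix m := rfl

/-- The recurrence that, with value 1 at `k = 0`, characterizes the binomial coefficients; it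
matches `unipotentCoeff_succ`. -/
theorem choose_succ_mul (x : ℂ) (k : ℕ) :
    (k + 1 : ℂ) * Ring.choose x (k + 1) + k * Ring.choose x k = Ring.choose x k * x := by
  rw [← sub_eq_zero]
  refine eq_zero_of_mem_polynomialFunctions (f := fun x => (k + 1 : ℂ) * Ring.choose x (k + 1) +
    k * Ring.choose x k - Ring.choose x k * x) ?_ (fun j => ?_) x
  · exact sub_mem (add_mem (mul_mem (const_mem_polynomialFunctions _)
      (choose_mem_polynomialFunctions _)) (mul_mem (const_mem_polynomialFunctions _)
      (choose_mem_polynomialFunctions _))) (mul_mem (choose_mem_polynomialFunctions _)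
      (Algebra.subset_adjoin rfl))
  · simp only [Ring.choose_natCast]
    rcases le_or_gt k j with h | h
    · have := Nat.choose_succ_right_eq j k
      have h2 : (j.choose (k + 1) : ℂ) * (k + 1) = j.choose k * (j - k) := by
        rw [← Nat.cast_sub h]
        exact_mod_cast this
      linear_combination h2
    · rw [Nat.choose_eq_zero_of_lt h, Nat.choose_eq_zero_of_lt (by omega)]
      simp

section Surjectivity

variable {q z₀ : ℂˣ} (Φ : localGaloisGroup q z₀)

/-- The component of `Φ` at the object `(ℂⁿ, A)`. -/
def component {n : ℕ} (A : GL (Fin n) ℂ) : GL (Fin n) ℂ := Φ.1 ⟨n, A⟩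

theorem mul_component {n p : ℕ} {A : GL (Fin n) ℂ} {B : GL (Fin p) ℂ}
    (F : Matrix (Fin p) (Fin n) ℂ) (h : F * A.val = B.val * F) :
    F * (component Φ A).val = (component Φ B).val * F :=
  Φ.2.1 ⟨n, A⟩ ⟨p, B⟩ (FlatHom.const q F h)

theorem component_glTensor {m n : ℕ} (A : GL (Fin m) ℂ) (B : GL (Fin n) ℂ) :
    component Φ (glTensor A B) = glTensor (component Φ A) (component Φ B) :=
  Φ.2.2.1 ⟨m, A⟩ ⟨n, B⟩

theorem component_one : component Φ (1 : GL (Fin 1) ℂ) = 1 := Φ.2.2.2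

/-- The character by which `Φ` acts on the objects of rank one. -/
def rankOneScalar (c : ℂˣ) : ℂˣ := GeneralLinearGroup.det (component Φ (scalarGL 1 c))

theorem component_rankOne (c : ℂˣ) :
    (component Φ (scalarGL 1 c)).val = (rankOneScalar Φ c : ℂ) • 1 := by
  ext i j
  fin_cases i; fin_cases j
  simp [rankOneScalar]

/-- The identification `ℂ ⊗ ℂⁿ ≃ ℂⁿ`, as a matrix. -/
def leftUnitor (n : ℕ) : Matrix (Fin n) (Fin (1 * n)) ℂ :=
  Matrix.of fun i l => if (finProdFinEquiv.symm l).2 = i then 1 else 0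

theorem leftUnitor_mulVec {n : ℕ} (u : Fin 1 → ℂ) (v : Fin n → ℂ) :
    leftUnitor n *ᵥ tensorVec u v = u 0 • v := by
  ext i
  simp only [leftUnitor, mulVec, dotProduct, tensorVec, of_apply]
  rw [← finProdFinEquiv.sum_comp]
  simp [Fintype.sum_prod_type]

/-- The unitor ℂ ⊗ ℂⁿ ≃ ℂⁿ is a morphism from (ℂ, c) ⊗ (ℂⁿ, A) to (ℂⁿ, cA), so naturality and tensor
compatibility combine. -/
theorem component_smul {n : ℕ} (c : ℂˣ) (A B : GL (Fin n) ℂ) (h : B.val = (c : ℂ) • A.val) :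
    (component Φ B).val = (rankOneScalar Φ c : ℂ) • (component Φ A).val := by
  have hnat := mul_component Φ (A := glTensor (scalarGL 1 c) A) (B := B) (leftUnitor n)
    (eq_of_forall_mulVec_tensorVec fun u v => by
      rw [← mulVec_mulVec, ← mulVec_mulVec, glTensor_val, finKronecker_mulVec, leftUnitor_mulVec,
        leftUnitor_mulVec, scalarGL_val, h, smul_mulVec, one_mulVec, smul_mulVec, mulVec_smul,
        Pi.smul_apply, smul_eq_mul, mul_smul, smul_comm])
  refine Matrix.toLin'.injective (LinearMap.ext fun v => ?_)
  have := congr_arg (fun M => M *ᵥ tensorVec (fun _ : Fin 1 => (1 : ℂ)) v) hnat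
  rw [component_glTensor, ← mulVec_mulVec, ← mulVec_mulVec, glTensor_val, finKronecker_mulVec,
    leftUnitor_mulVec, leftUnitor_mulVec, component_rankOne, smul_mulVec, one_mulVec,
    one_smul] at this
  rw [toLin'_apply, toLin'_apply, ← this, smul_mulVec, Pi.smul_apply, smul_eq_mul, mul_one]

/-- The character `γ` of the element `(γ, λ)` that corresponds to `Φ`. -/
def rankOneCharacter : ℂˣ →* ℂˣ :=
  MonoidHom.mk' (rankOneScalar Φ) fun c d => by
    have := component_smul Φ c (scalarGL 1 d) (scalarGL 1 (c * d)) (by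
      rw [scalarGL_val, scalarGL_val, smul_smul, Units.val_mul])
    rw [component_rankOne, component_rankOne, smul_smul] at this
    have h := congr_fun (congr_fun this 0) 0
    ext
    simpa using h

/-- The function `z` is a morphism (ℂ, 1) → (ℂ, q) with nonzero value at `z₀`. -/
theorem rankOneCharacter_q : rankOneCharacter Φ q = 1 := by
  let F : FlatHom q ⟨1, scalarGL 1 1⟩ ⟨1, scalarGL 1 q⟩ :=
    { toFun := fun z => z • 1
      meromorphic := fun i j => AnalyticOnNhd.meromorphicNFOn fun z _ => by
        simp only [Matrix.smul_apply, smul_eq_mul]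
        fun_prop
      equivariant := Filter.Eventually.of_forall fun z => by
        change ((q : ℂ) * z) • (1 : Matrix (Fin 1) (Fin 1) ℂ) * (scalarGL 1 1).val =
          (scalarGL 1 q).val * z • 1
        rw [map_one, scalarGL_val, Units.val_one, Matrix.mul_one, Matrix.smul_mul, Matrix.one_mul,
          smul_smul] }
  have h : F.toFun z₀ * (component Φ (scalarGL 1 1)).val =
    (component Φ (scalarGL 1 q)).val * F.toFun z₀ := Φ.2.1 _ _ F
  have h1 : rankOneScalar Φ 1 = 1 := map_one (rankOneCharacter Φ)
  rw [component_rankOne, component_rankOne, h1] at h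
  have h2 := congr_fun (congr_fun h 0) 0
  simp only [F, Units.val_one, one_smul, Matrix.smul_mul, Matrix.one_mul,
    Matrix.smul_apply, one_apply_eq, smul_eq_mul, mul_one] at h2
  refine Units.ext (mul_right_cancel₀ z₀.ne_zero ?_)
  rw [Units.val_one, one_mul]
  exact h2.symm

/-- The coefficients of the power series in `A - 1` by which `Φ` acts on unipotent objects. -/
def unipotentCoeff (k : ℕ) : ℂ :=
  ((component Φ (jordanGL (k + 1))).val *ᵥ stdVec (k + 1) 0) (Fin.last k)

/-- The map e_k ↦ Nᵏ v is a morphism from the Jordan block to (ℂⁿ, A) because Nᵐ v = 0; naturality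
is then read at e₀. -/
theorem component_mulVec_eq_sum_jordanGL {n : ℕ} (A : GL (Fin n) ℂ) {m : ℕ} {v : Fin n → ℂ}
    (hv : ((A : Matrix (Fin n) (Fin n) ℂ) - 1) ^ m *ᵥ v = 0) :
    (component Φ A).val *ᵥ v = ∑ k : Fin m, ((component Φ (jordanGL m)).val *ᵥ stdVec m 0) k •
      (((A : Matrix (Fin n) (Fin n) ℂ) - 1) ^ (k : ℕ) *ᵥ v) := by
  set N := (A : Matrix (Fin n) (Fin n) ℂ) - 1 with hN
  have hA : (A : Matrix (Fin n) (Fin n) ℂ) = 1 + N := by rw [hN]; abel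
  let F : Matrix (Fin n) (Fin m) ℂ := Matrix.of fun i k => (N ^ (k : ℕ) *ᵥ v) i
  have hF : ∀ w : Fin m → ℂ, F *ᵥ w = ∑ k : Fin m, w k • (N ^ (k : ℕ) *ᵥ v) := by
    intro w
    ext i
    simp [F, mulVec, dotProduct, mul_comm]
  have hFe : ∀ k ≤ m, F *ᵥ stdVec m k = N ^ k *ᵥ v := by
    intro k hk
    rcases hk.lt_or_eq with h | rfl
    · lift k to Fin m using h
      rw [stdVec_eq_single, mulVec_single_one]
      rfl
    · rw [stdVec_of_le le_rfl, hv, mulVec_zero]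
  have hnat := mul_component Φ (A := jordanGL m) (B := A) F
    (eq_of_forall_stdVec fun k hk => by
      rw [jordanGL_val, ← mulVec_mulVec, add_mulVec, one_mulVec, shiftMatrix_mulVec_stdVec,
        mulVec_add, hFe _ hk, hFe _ hk.le, ← mulVec_mulVec, hFe _ hk.le, hA, add_mulVec, one_mulVec,
        mulVec_mulVec, pow_succ'])
  have := congr_arg (fun M => M *ᵥ stdVec m 0) hnat
  rw [← mulVec_mulVec, ← mulVec_mulVec, hFe 0 (Nat.zero_le m), pow_zero, one_mulVec, hF] at this
  exact this.symm

/-- Applying the expansion to e₀ in the block of size `k + 1` and reading the last coordinate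
isolates the `k`-th coefficient: it does not depend on `m`. -/
theorem component_jordanGL {m : ℕ} (k : Fin m) :
    ((component Φ (jordanGL m)).val *ᵥ stdVec m 0) k = unipotentCoeff Φ k := by
  have h := component_mulVec_eq_sum_jordanGL Φ (jordanGL (k + 1)) (m := m)
    (v := stdVec (k + 1) 0) (by
      rw [jordanGL_val, add_sub_cancel_left, shiftMatrix_pow_mulVec_stdVec,
        stdVec_of_le (by omega)])
  have h1 := congr_fun h (Fin.last k)
  rw [jordanGL_val, add_sub_cancel_left] at h1
  rw [unipotentCoeff]
  refine Eq.trans ?_ h1.symm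
  simp only [shiftMatrix_pow_mulVec_stdVec, zero_add, Finset.sum_apply, Pi.smul_apply, stdVec,
    Fin.val_last, smul_eq_mul, mul_ite, mul_one, mul_zero, ← Fin.ext_iff]
  rw [Finset.sum_ite_eq, if_pos (Finset.mem_univ _)]

theorem component_mulVec_eq_sum {n : ℕ} (A : GL (Fin n) ℂ) {m : ℕ} {v : Fin n → ℂ}
    (hv : ((A : Matrix (Fin n) (Fin n) ℂ) - 1) ^ m *ᵥ v = 0) :
    (component Φ A).val *ᵥ v = ∑ k ∈ Finset.range m, unipotentCoeff Φ k •
      (((A : Matrix (Fin n) (Fin n) ℂ) - 1) ^ k *ᵥ v) := by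
  rw [component_mulVec_eq_sum_jordanGL Φ A hv, Finset.sum_range]
  simp only [component_jordanGL]

theorem unipotentCoeff_zero : unipotentCoeff Φ 0 = 1 := by
  have h := component_mulVec_eq_sum Φ (1 : GL (Fin 1) ℂ) (m := 1) (v := fun _ => 1) (by simp)
  rw [component_one] at h
  have h1 := congr_fun h 0
  simpa using h1.symm

theorem jordan_tensor_pow_mulVec (m k : ℕ) :
    (finKronecker (1 + shiftMatrix m) (1 + shiftMatrix 2) - 1) ^ k *ᵥ
      tensorVec (stdVec m 0) (stdVec 2 0) =
    tensorVec (stdVec m k) (stdVec 2 0) +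
      -- At `k = 0` the truncated subtraction is harmless, as the factor `k` vanishes.
      (k : ℂ) • tensorVec (stdVec m (k - 1) + stdVec m k) (stdVec 2 1) := by
  have h0 : ∀ i, (finKronecker (1 + shiftMatrix m) (1 + shiftMatrix 2) - 1) *ᵥ
      tensorVec (stdVec m i) (stdVec 2 0) = tensorVec (stdVec m (i + 1)) (stdVec 2 0) +
        tensorVec (stdVec m i + stdVec m (i + 1)) (stdVec 2 1) := by
    intro i
    rw [sub_mulVec, one_mulVec, finKronecker_mulVec, add_mulVec, add_mulVec, one_mulVec, one_mulVec,
      shiftMatrix_mulVec_stdVec, shiftMatrix_mulVec_stdVec]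
    ext l
    simp only [tensorVec, Pi.add_apply, Pi.sub_apply]
    ring
  have h1 : ∀ i, (finKronecker (1 + shiftMatrix m) (1 + shiftMatrix 2) - 1) *ᵥ
      tensorVec (stdVec m i + stdVec m (i + 1)) (stdVec 2 1) =
        tensorVec (stdVec m (i + 1) + stdVec m (i + 2)) (stdVec 2 1) := by
    intro i
    rw [sub_mulVec, one_mulVec, finKronecker_mulVec, add_mulVec, add_mulVec, one_mulVec, one_mulVec,
      shiftMatrix_mulVec_stdVec, mulVec_add, shiftMatrix_mulVec_stdVec, shiftMatrix_mulVec_stdVec,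
      stdVec_of_le (le_refl 2)]
    ext l
    simp only [tensorVec, Pi.add_apply, Pi.sub_apply, Pi.zero_apply]
    ring
  induction k with
  | zero => simp
  | succ k ih =>
    rw [pow_succ', ← mulVec_mulVec, ih, mulVec_add, h0, mulVec_smul]
    cases k with
    | zero => simp
    | succ k =>
      simp only [Nat.add_sub_cancel, h1]
      rw [add_assoc]
      congr 1
      push_cast
      module

theorem unipotentCoeff_succ (j : ℕ) :
    (j + 1 : ℂ) * unipotentCoeff Φ (j + 1) + j * unipotentCoeff Φ j =
      unipotentCoeff Φ j * unipotentCoeff Φ 1 := by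
  have hz : ∀ m, shiftMatrix m ^ m *ᵥ stdVec m 0 = 0 := fun m => by
    rw [shiftMatrix_pow_self, zero_mulVec]
  have h := component_mulVec_eq_sum Φ (glTensor (jordanGL (j + 2)) (jordanGL 2))
    (nilpotentPart_finKronecker_pow_mulVec (hz (j + 2)) (hz 2))
  rw [component_glTensor, glTensor_val, glTensor_val, jordanGL_val, jordanGL_val,
    finKronecker_mulVec] at h
  -- At the coordinate e_j ⊗ e₁ the tensor side gives a_j a₁; in the expansion only the terms `k =
  -- j` and `k = j + 1` contribute.
  have h1 := congr_fun h (finProdFinEquiv (⟨j, by omega⟩, 1))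
  simp only [jordan_tensor_pow_mulVec, tensorVec, Equiv.symm_apply_apply, Finset.sum_apply,
    Pi.smul_apply, Pi.add_apply, smul_eq_mul] at h1
  rw [component_jordanGL, component_jordanGL] at h1
  simp only [stdVec, Fin.val_one, one_ne_zero, if_false, if_true, mul_zero, zero_add, mul_one,
    mul_add, Finset.sum_add_distrib, mul_ite] at h1
  rw [h1, Finset.sum_ite_eq, if_pos (Finset.mem_range.2 (by omega)), Finset.sum_range_succ']
  simp only [Nat.add_sub_cancel]
  rw [Finset.sum_ite_eq, if_pos (Finset.mem_range.2 (by omega))]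
  push_cast
  simp
  ring

theorem unipotentCoeff_eq_choose (k : ℕ) :
    unipotentCoeff Φ k = Ring.choose (unipotentCoeff Φ 1) k := by
  induction k with
  | zero => rw [unipotentCoeff_zero, Ring.choose_zero_right]
  | succ k ih =>
    have h1 := unipotentCoeff_succ Φ k
    have h2 := choose_succ_mul (unipotentCoeff Φ 1) k
    rw [ih, ← h2] at h1
    exact mul_left_cancel₀ (Nat.cast_add_one_ne_zero k) (add_right_cancel h1)

/-- Writing A = c · (c⁻¹A), the factor `c` contributes γ(c), and c⁻¹A is unipotent on `v`, so the
universal series applies. -/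
theorem actsAs_apply (X : FlatObj) :
    ActsAs (rankOneCharacter Φ, Multiplicative.ofAdd (unipotentCoeff Φ 1)) X.mat.val (Φ.1 X).val := by
  obtain ⟨n, A⟩ := X
  intro c m v hv
  have hB : (scalarGL n c⁻¹ * A).val = ((c⁻¹ : ℂˣ) : ℂ) • A.val := by
    rw [Units.val_mul, scalarGL_val, Matrix.smul_mul, Matrix.one_mul]
  have hN : (scalarGL n c⁻¹ * A).val - 1 = nilpotentPart A.val c := by rw [hB, nilpotentPart]
  change (component Φ A).val *ᵥ v =
    (rankOneScalar Φ c : ℂ) • (binomialSum _ m (nilpotentPart A.val c) *ᵥ v)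
  change nilpotentPart A.val c ^ m *ᵥ v = 0 at hv
  rw [component_smul Φ c (scalarGL n c⁻¹ * A) A (by rw [hB, smul_smul, Units.mul_inv, one_smul]),
    smul_mulVec, component_mulVec_eq_sum Φ _ (m := m) (by rw [hN]; exact hv), binomialSum_mulVec, hN]
  simp only [← unipotentCoeff_eq_choose Φ, toAdd_ofAdd]

end Surjectivity

/-- Rank-one objects detect γ, and the Jordan block of size 2 detects λ. -/
theorem toLocalGaloisGroup_injective {q : ℂˣ} (hq : 1 < ‖(q : ℂ)‖) (z₀ : ℂˣ) :
    Function.Injective (toLocalGaloisGroup hq z₀) := by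
  rintro ⟨⟨γ, x⟩, hg⟩ ⟨⟨γ', x'⟩, hg'⟩ h
  have h1 : ∀ X : FlatObj, (action (γ, x) X.mat).val = (action (γ', x') X.mat).val := fun X =>
    congr_arg Units.val (congr_fun (congr_arg Subtype.val h) X)
  have hγ : γ = γ' := by
    ext c
    have e : ∀ g, (action g (scalarGL 1 c)).val = (g.1 c : ℂ) • 1 := fun g => by
      refine (actsAs_action g (scalarGL 1 c)).unique (scalarGL 1 c).isUnit ?_
      rw [scalarGL_val]
      exact actsAs_smul_one g c
    have h2 := h1 ⟨1, scalarGL 1 c⟩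
    rw [e, e] at h2
    simpa using congr_fun (congr_fun h2 0) 0
  have hx : x = x' := by
    have e : ∀ g, (action g (jordanGL 2)).val *ᵥ stdVec 2 0 =
        stdVec 2 0 + Multiplicative.toAdd g.2 • stdVec 2 1 := fun g => by
      have hN : nilpotentPart (jordanGL 2).val 1 = shiftMatrix 2 := by
        rw [nilpotentPart, jordanGL_val]; simp
      have := actsAs_action g (jordanGL 2) 1 2 (stdVec 2 0) (by
        rw [hN, shiftMatrix_pow_self, zero_mulVec])
      rw [this, hN, map_one, Units.val_one, one_smul, binomialSum_mulVec]
      rw [Finset.sum_range_succ, Finset.sum_range_one, shiftMatrix_pow_mulVec_stdVec,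
        shiftMatrix_pow_mulVec_stdVec, Ring.choose_zero_right, Ring.choose_one_right, one_smul]
    have h2 : (action (γ, x) (jordanGL 2)).val = (action (γ, x') (jordanGL 2)).val :=
      hγ ▸ h1 ⟨2, jordanGL 2⟩
    replace h2 := congr_arg (· *ᵥ stdVec 2 0) h2
    simp only [e] at h2
    have h3 := congr_fun h2 1
    simpa [stdVec] using h3
  subst hγ hx
  rfl

theorem toLocalGaloisGroup_surjective {q : ℂˣ} (hq : 1 < ‖(q : ℂ)‖) (z₀ : ℂˣ) :
    Function.Surjective (toLocalGaloisGroup hq z₀) := fun Φ =>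
  ⟨⟨(rankOneCharacter Φ, Multiplicative.ofAdd (unipotentCoeff Φ 1)), rankOneCharacter_q Φ⟩,
    Subtype.ext (funext fun X => (actsAs_apply Φ X).eq_action.symm)⟩

/-- The identification of `{(γ, λ) | γ(q) = 1}` with the local Galois group. -/
def localGaloisGroupEquiv {q : ℂˣ} (hq : 1 < ‖(q : ℂ)‖) (z₀ : ℂˣ) :
    evalKer q ≃* localGaloisGroup q z₀ :=
  MulEquiv.ofBijective (toLocalGaloisGroup hq z₀)
    ⟨toLocalGaloisGroup_injective hq z₀, toLocalGaloisGroup_surjective hq z₀⟩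

/-! ### Zariski density -/

theorem neg_mem_polynomialFunctions {f : ℂ → ℂ} (hf : f ∈ polynomialFunctions) :
    (fun x => f (-x)) ∈ polynomialFunctions := by
  obtain ⟨P, hP⟩ := exists_polynomial_of_mem hf
  have : (fun x => f (-x)) = fun x => (P.comp (-Polynomial.X)).eval x := by
    funext x
    rw [hP, Polynomial.eval_comp, Polynomial.eval_neg, Polynomial.eval_X]
  rw [this]
  exact polynomial_mem_polynomialFunctions _

theorem actionMatrix_apply_mem_polynomialFunctions (γ : ℂˣ →* ℂˣ) {n : ℕ} (A : GL (Fin n) ℂ)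
    (i j : Fin n) :
    (fun x => actionMatrix (γ, Multiplicative.ofAdd x) A i j) ∈ polynomialFunctions := by
  have : (fun x => actionMatrix (γ, Multiplicative.ofAdd x) A i j) = ∑ k,
      (fun _ => conjDiagonal (dunfordBasis A) (fun i => (γ (dunfordEigenvalues A i) : ℂ)) i k) *
        (fun x : ℂ => binomialSum x n (dunfordUnipotent A - 1) k j) := by
    funext x
    simp [actionMatrix, Matrix.mul_apply]
  rw [this]
  exact sum_mem fun k _ => mul_mem (const_mem_polynomialFunctions _)
    (binomialSum_apply_mem_polynomialFunctions _ _ _ _)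

/-- The character of `ℂˣ ⧸ ⟨q⟩` induced by a character `γ` of `ℂˣ` with `γ(q) = 1`. -/
def quotientCharacter {q : ℂˣ} (γ : ℂˣ →* ℂˣ) (h : γ q = 1) : ℂˣ ⧸ Subgroup.zpowers q →* ℂ :=
  (Units.coeHom ℂ).comp (QuotientGroup.lift _ γ (by
    rintro _ ⟨k, rfl⟩
    simp [h]))

theorem quotientCharacter_mk {q : ℂˣ} (γ : ℂˣ →* ℂˣ) (h : γ q = 1) (c : ℂˣ) :
    quotientCharacter γ h (QuotientGroup.mk c) = γ c := rfl

/-- The evaluation at `γ` of a linear combination of elements of `ℂˣ ⧸ ⟨q⟩`. -/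
def evalCharacter {q : ℂˣ} (γ : ℂˣ →* ℂˣ) (h : γ q = 1) :
    MonoidAlgebra ℂ (ℂˣ ⧸ Subgroup.zpowers q) →ₐ[ℂ] ℂ :=
  MonoidAlgebra.lift ℂ ℂ _ (quotientCharacter γ h)

/-- Such an entry is ∑ₖ γ(cₖ) bₖ with bₖ independent of γ, and γ(cₖ) depends only on the class of cₖ
modulo q^ℤ. -/
theorem exists_evalCharacter_eq {q : ℂˣ} {n : ℕ} (Q : GL (Fin n) ℂ) (c : Fin n → ℂˣ)
    (B : Matrix (Fin n) (Fin n) ℂ) (i j : Fin n) :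
    ∃ a : MonoidAlgebra ℂ (ℂˣ ⧸ Subgroup.zpowers q), ∀ (γ : ℂˣ →* ℂˣ) (h : γ q = 1),
      (conjDiagonal Q (fun i => (γ (c i) : ℂ)) * B) i j = evalCharacter γ h a := by
  refine ⟨∑ k, MonoidAlgebra.single (QuotientGroup.mk (c k))
    (Q.val i k * (((Q⁻¹ : GL (Fin n) ℂ) : Matrix (Fin n) (Fin n) ℂ) * B) k j), fun γ h => ?_⟩
  rw [map_sum, conjDiagonal, Matrix.mul_assoc, Matrix.mul_apply]
  refine Finset.sum_congr rfl fun k _ => ?_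
  rw [evalCharacter, MonoidAlgebra.lift_single, quotientCharacter_mk, mul_diagonal, smul_eq_mul]
  ring

/-- The first condition makes `c` equal to q^y with y real; the second makes y an integer. -/
theorem mem_zpowers_of_gamma_eq_one {q : ℂˣ} {τ : ℂ}
    (hq : (q : ℂ) = Complex.exp (-2 * Real.pi * Complex.I * τ)) {c : ℂˣ} (h1 : gamma₁ τ c = 1)
    (h2 : gamma₂ τ c = 1) : c ∈ Subgroup.zpowers q := by
  have h1' : c = qPow τ (qExponent τ c) := mul_inv_eq_one.1 h1
  have h2' : Complex.exp (2 * Real.pi * Complex.I * qExponent τ c) = 1 := congr_arg Units.val h2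
  obtain ⟨k, hk⟩ := Complex.exp_eq_one_iff.1 h2'
  have hy : (qExponent τ c : ℂ) = k := by
    refine mul_left_cancel₀ Complex.two_pi_I_ne_zero ?_
    rw [hk, mul_comm]
  refine ⟨k, Units.ext ?_⟩
  rw [h1']
  change ((q ^ k : ℂˣ) : ℂ) = Complex.exp (-2 * Real.pi * Complex.I * τ * qExponent τ c)
  rw [hy, Units.val_zpow_eq_zpow_val, hq, ← Complex.exp_int_mul, mul_comm]

theorem gamma₁_q {q : ℂˣ} {τ : ℂ} (hτ : 0 < τ.im)
    (hq : (q : ℂ) = Complex.exp (-2 * Real.pi * Complex.I * τ)) : gamma₁ τ q = 1 := by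
  have : q = 1 * qPow τ 1 := by ext; simp [qPow, hq]
  rw [this, gamma₁_apply hτ 1 (by simp)]

theorem gamma₂_q {q : ℂˣ} {τ : ℂ} (hτ : 0 < τ.im)
    (hq : (q : ℂ) = Complex.exp (-2 * Real.pi * Complex.I * τ)) : gamma₂ τ q = 1 := by
  have : q = 1 * qPow τ 1 := by ext; simp [qPow, hq]
  ext
  rw [this, gamma₂_apply hτ 1 (by simp), Complex.ofReal_one, mul_one, Complex.exp_two_pi_mul_I,
    Units.val_one]

theorem apply_q_of_mem_closure {q : ℂˣ} {τ : ℂ} (hτ : 0 < τ.im)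
    (hq : (q : ℂ) = Complex.exp (-2 * Real.pi * Complex.I * τ)) {γ : ℂˣ →* ℂˣ}
    (h : γ ∈ Subgroup.closure {gamma₁ τ, gamma₂ τ}) : γ q = 1 := by
  have : Subgroup.closure {gamma₁ τ, gamma₂ τ} ≤ (MonoidHom.eval q).ker := by
    rw [Subgroup.closure_le]
    rintro _ (rfl | rfl)
    · exact gamma₁_q hτ hq
    · exact gamma₂_q hτ hq
  exact this h

/-- A linear combination of elements of `ℂˣ ⧸ ⟨q⟩` that vanishes on `⟨γ₁, γ₂⟩` is zero. -/
theorem eq_zero_of_evalCharacter_eq_zero {q : ℂˣ} {τ : ℂ} (hτ : 0 < τ.im)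
    (hq : (q : ℂ) = Complex.exp (-2 * Real.pi * Complex.I * τ))
    (a : MonoidAlgebra ℂ (ℂˣ ⧸ Subgroup.zpowers q))
    (h : ∀ (γ : ℂˣ →* ℂˣ) (hγ : γ ∈ Subgroup.closure {gamma₁ τ, gamma₂ τ}),
      evalCharacter γ (apply_q_of_mem_closure hτ hq hγ) a = 0) : a = 0 := by
  -- Duality: a class in ℂˣ/q^ℤ becomes a character of ⟨γ₁, γ₂⟩, so that independence of characters
  -- applies to evaluations.
  let e : ℂˣ ⧸ Subgroup.zpowers q → (Subgroup.closure {gamma₁ τ, gamma₂ τ} →* ℂ) := fun x =>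
    { toFun := fun γ => quotientCharacter γ.1 (apply_q_of_mem_closure hτ hq γ.2) x
      map_one' := by
        induction x using QuotientGroup.induction_on with | H c => rfl
      map_mul' := fun γ γ' => by
        induction x using QuotientGroup.induction_on with
        | H c => simp [quotientCharacter_mk] }
  have he : Function.Injective e := by
    intro x y hxy
    induction x using QuotientGroup.induction_on with | H c => ?_
    induction y using QuotientGroup.induction_on with | H d => ?_
    have h' : ∀ γ ∈ Subgroup.closure {gamma₁ τ, gamma₂ τ}, γ (c⁻¹ * d) = 1 := fun γ hγ => by
      rw [map_mul, map_inv, inv_mul_eq_one]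
      have := DFunLike.congr_fun hxy ⟨γ, hγ⟩
      exact Units.ext this
    exact QuotientGroup.eq.2 (mem_zpowers_of_gamma_eq_one hq
      (h' _ (Subgroup.subset_closure (by simp))) (h' _ (Subgroup.subset_closure (by simp))))
  have hli := (linearIndependent_monoidHom (Subgroup.closure {gamma₁ τ, gamma₂ τ}) ℂ).comp e he
  refine MonoidAlgebra.coeff_injective (linearIndependent_iff.1 hli a.coeff ?_)
  funext γ
  rw [Finsupp.linearCombination_apply, Finsupp.sum, Finset.sum_apply, Pi.zero_apply,
    ← h γ.1 γ.2, evalCharacter, MonoidAlgebra.lift_apply]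
  rfl

section Density

variable {q z₀ : ℂˣ}

theorem regularFunctions_comp_mem_polynomialFunctions (hq : 1 < ‖(q : ℂ)‖)
    {f : localGaloisGroup q z₀ → ℂ} (hf : f ∈ regularFunctions q z₀) (γ : ℂˣ →* ℂˣ)
    (hγ : γ q = 1) :
    (fun x : ℂ => f (localGaloisGroupEquiv hq z₀ ⟨(γ, Multiplicative.ofAdd x), hγ⟩)) ∈
      polynomialFunctions := by
  induction hf using Algebra.adjoin_induction with
  | mem f hf =>
    rcases hf with ⟨X, i, j, rfl⟩ | ⟨X, i, j, rfl⟩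
    · exact actionMatrix_apply_mem_polynomialFunctions γ X.mat i j
    · exact neg_mem_polynomialFunctions
        (actionMatrix_apply_mem_polynomialFunctions γ⁻¹ X.mat i j)
  | algebraMap r => exact const_mem_polynomialFunctions r
  | add f g _ _ hf hg => exact add_mem hf hg
  | mul f g _ _ hf hg => exact mul_mem hf hg

/-- One element `a` serves all γ at once. Sums and products pass through because `evalCharacter` is
an algebra morphism. -/
theorem exists_regularFunctions_comp_eq_evalCharacter (hq : 1 < ‖(q : ℂ)‖)
    {f : localGaloisGroup q z₀ → ℂ} (hf : f ∈ regularFunctions q z₀) (x : ℂ) :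
    ∃ a : MonoidAlgebra ℂ (ℂˣ ⧸ Subgroup.zpowers q), ∀ (γ : ℂˣ →* ℂˣ) (hγ : γ q = 1),
      f (localGaloisGroupEquiv hq z₀ ⟨(γ, Multiplicative.ofAdd x), hγ⟩) = evalCharacter γ hγ a := by
  induction hf using Algebra.adjoin_induction with
  | mem f hf =>
    rcases hf with ⟨X, i, j, rfl⟩ | ⟨X, i, j, rfl⟩
    · obtain ⟨a, ha⟩ := exists_evalCharacter_eq (q := q) (dunfordBasis X.mat)
        (dunfordEigenvalues X.mat) (binomialSum x X.rank (dunfordUnipotent X.mat - 1)) i j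
      refine ⟨a, fun γ hγ => ?_⟩
      rw [← ha γ hγ]
      rfl
    -- The inverse matrix is the action of (γ⁻¹, -x), and γ⁻¹(c) = γ(c⁻¹).
    · obtain ⟨a, ha⟩ := exists_evalCharacter_eq (q := q) (dunfordBasis X.mat)
        (fun k => (dunfordEigenvalues X.mat k)⁻¹)
        (binomialSum (-x) X.rank (dunfordUnipotent X.mat - 1)) i j
      refine ⟨a, fun γ hγ => ?_⟩
      rw [← ha γ hγ]
      simp only [map_inv]
      rfl
  | algebraMap r => exact ⟨algebraMap ℂ _ r, fun γ hγ => (AlgHom.commutes _ r).symm⟩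
  | add f g _ _ hf hg =>
    obtain ⟨a, ha⟩ := hf
    obtain ⟨b, hb⟩ := hg
    exact ⟨a + b, fun γ hγ => by rw [map_add, ← ha, ← hb]; rfl⟩
  | mul f g _ _ hf hg =>
    obtain ⟨a, ha⟩ := hf
    obtain ⟨b, hb⟩ := hg
    exact ⟨a * b, fun γ hγ => by rw [map_mul, ← ha, ← hb]; rfl⟩

/-- The sets {f ≠ 0} are stable under intersection, by taking products, so they form a basis and
density can be tested on them alone. -/
theorem isZariskiDense_of_forall_regularFunctions {S : Set (localGaloisGroup q z₀)}
    (h : ∀ f ∈ regularFunctions q z₀, (∀ Φ ∈ S, f Φ = 0) → f = 0) : IsZariskiDense S := by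
  let := zariskiTopology q z₀
  have hB : TopologicalSpace.IsTopologicalBasis
      {U : Set (localGaloisGroup q z₀) | ∃ f ∈ regularFunctions q z₀, U = {Φ | f Φ ≠ 0}} :=
    { exists_subset_inter := by
        rintro _ ⟨f, hf, rfl⟩ _ ⟨g, hg, rfl⟩ Φ hΦ
        exact ⟨_, ⟨f * g, mul_mem hf hg, rfl⟩, mul_ne_zero hΦ.1 hΦ.2,
          fun Ψ hΨ => ⟨left_ne_zero_of_mul hΨ, right_ne_zero_of_mul hΨ⟩⟩
      sUnion_eq := Set.eq_univ_of_forall fun Φ =>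
        ⟨_, ⟨1, one_mem _, rfl⟩, one_ne_zero⟩
      eq_generateFrom := rfl }
  refine hB.dense_iff.2 ?_
  rintro _ ⟨f, hf, rfl⟩ ⟨Φ, hΦ⟩
  by_contra hne
  refine hΦ (congr_fun (h f hf fun Ψ hΨ => ?_) Φ)
  by_contra hfΨ
  exact hne ⟨Ψ, hfΨ, hΨ⟩

end Density

theorem one_lt_norm_of_eq_exp {q : ℂˣ} {τ : ℂ} (hτ : 0 < τ.im)
    (hq : (q : ℂ) = Complex.exp (-2 * Real.pi * Complex.I * τ)) : 1 < ‖(q : ℂ)‖ := by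
  rw [hq, Complex.norm_exp, Real.one_lt_exp_iff]
  have := mul_pos Real.two_pi_pos hτ
  simpa using this

theorem isZariskiDense_localFundamentalGroup {q : ℂˣ} {τ : ℂ} (hτ : 0 < τ.im)
    (hq : (q : ℂ) = Complex.exp (-2 * Real.pi * Complex.I * τ)) (z₀ : ℂˣ) :
    IsZariskiDense (localGaloisGroupEquiv (one_lt_norm_of_eq_exp hτ hq) z₀ ''
      {g : evalKer q | (g : ZAlg) ∈ localFundamentalGroup τ}) := by
  have hq1 := one_lt_norm_of_eq_exp hτ hq
  refine isZariskiDense_of_forall_regularFunctions fun f hf hS => ?_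
  -- The unipotent direction comes first: the family of characters must be known to vanish at every
  -- complex `x` before γ is varied.
  have h1 : ∀ (γ : ℂˣ →* ℂˣ) (hγ : γ ∈ Subgroup.closure {gamma₁ τ, gamma₂ τ}) (x : ℂ),
      f (localGaloisGroupEquiv hq1 z₀ ⟨(γ, Multiplicative.ofAdd x),
        apply_q_of_mem_closure hτ hq hγ⟩) = 0 := fun γ hγ x =>
    eq_zero_of_mem_polynomialFunctions
      (regularFunctions_comp_mem_polynomialFunctions hq1 hf γ (apply_q_of_mem_closure hτ hq hγ))
      (fun j => hS _ ⟨_, ⟨hγ, ⟨(j : ℤ), by simp⟩⟩, rfl⟩) x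
  funext Φ
  obtain ⟨⟨⟨γ, x⟩, hγ⟩, rfl⟩ := (localGaloisGroupEquiv hq1 z₀).surjective Φ
  obtain ⟨a, ha⟩ := exists_regularFunctions_comp_eq_evalCharacter hq1 hf (Multiplicative.toAdd x)
  have ha0 := eq_zero_of_evalCharacter_eq_zero hτ hq a fun γ' hγ' => by rw [← ha, h1 γ' hγ']
  exact (ha γ hγ).trans (by rw [ha0, map_zero]; rfl)

end QDiff

end

theorem mainTheorem3 (q : ℂˣ) (τ : ℂ) (hτ : 0 < τ.im)
    (hq : (q : ℂ) = Complex.exp (-2 * Real.pi * Complex.I * τ)) (z₀ : ℂˣ) :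
    QDiff.localFundamentalGroup τ ≤ QDiff.evalKer q ∧
    ∃ ι : QDiff.evalKer q ≃* QDiff.localGaloisGroup q z₀,
      (∀ (g : QDiff.evalKer q) (X : QDiff.FlatObj),
        QDiff.IsIncarnation (g : QDiff.ZAlg) X.mat
          ((ι g : ∀ X : QDiff.FlatObj, GL (Fin X.rank) ℂ) X)) ∧
      QDiff.IsZariskiDense
        (ι '' {g : QDiff.evalKer q | (g : QDiff.ZAlg) ∈ QDiff.localFundamentalGroup τ}) :=
  ⟨fun _ hg => QDiff.apply_q_of_mem_closure hτ hq hg.1,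
    QDiff.localGaloisGroupEquiv (QDiff.one_lt_norm_of_eq_exp hτ hq) z₀,
    fun g X => QDiff.isIncarnation_action g X.mat,
    QDiff.isZariskiDense_localFundamentalGroup hτ hq z₀⟩
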